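/- Let $n,d,p\ge 1$ be integers, let $\Sigma^\natural\in\mathbb R^{p\times p}$ be a covariance matrix (symmetric positive semidefinite) with unit diagonal, and let $\sigma\ge 0$. Let $\tilde A\in\mathbb R^{d\times p}$ have i.i.d. entries $\tilde A_{ij}\sim N(0,1/d)$, let $X^{(1)},\dots,X^{(n)}$ be i.i.d. $N(0,\Sigma^\natural)$ in $\mathbb R^p$, let $W^{(1)},\dots,W^{(n)}$ be i.i.d. $N(0,\sigma^2 I_d)$, with $\tilde A$, $(X^{(s)})_s$, $(W^{(s)})_s$ mutually independent, and observe $Y^{(s)}=\tilde A X^{(s)}+W^{(s)}$, $1\le s\le n$. Consider the estimator \[ \widehat\Sigma^{\mathrm{param}}_n = I+\frac{d}{d+1}\Big[\tilde A^{\mathsf T}\Big(\frac1n\sum_{s=1}^n Y^{(s)}Y^{(s)\mathsf T}\Big)\tilde A\Big]_{\mathrm{off}}, \] where $[\cdot]_{\mathrm{off}}$ keeps the off-diagonal entries and sets the diagonal ones to $0$. Write $\|M\|_\infty=\max_{i,j}|M_{ij}|$, $\|M\|_{\mathrm{off},F}=(\sum_{i\ne j}M_{ij}^2)^{1/2}$,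 $a\vee b=\max(a,b)$, let $\Sigma^\natural_i$ be the $i$-th column of $\Sigma^\natural$, and for $C>0$ put \begin{align*} \tau_\infty = C\Big[&\sqrt{\tfrac{\log p}{n}}+\sqrt{\tfrac{\log p}{d}}\,\max_i\|\Sigma^\natural_i\|_2+\tfrac{\log p}{d}\big(1+\tfrac pd\big)\|\Sigma^\natural\|_{\mathrm{off},F}+\tfrac{\sqrt p\,\log p}{\sqrt{nd}}+\tfrac{p(\log p)^{3/2}}{\sqrt n\, d}\big(1+\tfrac pd\big)\\ &+\tfrac{\sqrt{p\log p}}{d}+\tfrac{p\sqrt{\log p}}{d^{3/2}}+\sigma^2\Big(1+\sqrt{\tfrac{\log p}{d}}\Big)\sqrt{\tfrac{\log p}{d}}\Big(1+\sqrt{\tfrac dn}\vee\tfrac dn\Big)\Big]. \end{align*} Then for every $K>0$ there are constants $c_0,c_1,c_2,c_3,c_4,C>0$, depending only on $K$, such that for all $n,d,p,\Sigma^\natural,\sigma$ as above with $\log p\le K n$, \[ \Pr\big(\|\widehat\Sigma^{\mathrm{param}}_n-\Sigma^\natural\|_\infty\le\tau_\infty\big)\ \ge\ 1-c_0p^{-1}-c_1p^2e^{-c_2d}-c_3p^2e^{-c_4p}.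 \] -/

import Mathlib

open MeasureTheory ProbabilityTheory
open scoped NNReal Matrix

namespace IndirectCov

noncomputable section

/-- Joint law of `(A, (X⁽¹⁾,…,X⁽ⁿ⁾), (W⁽¹⁾,…,W⁽ⁿ⁾))`: the entries of the `d × p` sensing matrix
`A` are i.i.d. `N(0, 1/d)`, the signals `X⁽ˢ⁾` are i.i.d. `N(0, S)` in `ℝᵖ`, the entries of the
noise vectors `W⁽ˢ⁾` are i.i.d. `N(0, σ²)`, and `A`, `X`, `W` are mutually independent. -/
def modelLaw (n d p : ℕ) (S : Matrix (Fin p) (Fin p) ℝ) (σ : ℝ≥0) :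
    Measure ((Fin d → Fin p → ℝ) × (Fin n → EuclideanSpace ℝ (Fin p)) × (Fin n → Fin d → ℝ)) :=
  (Measure.pi fun _ : Fin d => Measure.pi fun _ : Fin p => gaussianReal 0 ((d : ℝ≥0)⁻¹)).prod
    ((Measure.pi fun _ : Fin n => multivariateGaussian 0 S).prod
      (Measure.pi fun _ : Fin n => Measure.pi fun _ : Fin d => gaussianReal 0 (σ ^ 2)))

/-- The observations `Y⁽ˢ⁾ = A X⁽ˢ⁾ + W⁽ˢ⁾`. -/
def obs {n d p : ℕ} (A : Fin d → Fin p → ℝ) (X : Fin n → EuclideanSpace ℝ (Fin p))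
    (W : Fin n → Fin d → ℝ) (s : Fin n) : Fin d → ℝ :=
  Matrix.of A *ᵥ (X s).ofLp + W s

/-- The part of a square matrix off the diagonal, with zeros on the diagonal. -/
def offDiag {p : ℕ} (M : Matrix (Fin p) (Fin p) ℝ) : Matrix (Fin p) (Fin p) ℝ :=
  Matrix.of fun i j => if i = j then 0 else M i j

/-- The empirical second-moment matrix `(1/n) ∑ₛ Y⁽ˢ⁾ Y⁽ˢ⁾ᵀ`. -/
def empMoment {n d : ℕ} (Y : Fin n → Fin d → ℝ) : Matrix (Fin d) (Fin d) ℝ :=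
  (n : ℝ)⁻¹ • ∑ s, Matrix.vecMulVec (Y s) (Y s)

/-- The estimator `I + d/(d+1) [Aᵀ ((1/n) ∑ₛ Y⁽ˢ⁾ Y⁽ˢ⁾ᵀ) A]_off`. -/
def covEstimator {n d p : ℕ} (A : Fin d → Fin p → ℝ) (Y : Fin n → Fin d → ℝ) :
    Matrix (Fin p) (Fin p) ℝ :=
  1 + ((d : ℝ) / ((d : ℝ) + 1)) • offDiag ((Matrix.of A)ᵀ * empMoment Y * Matrix.of A)

/-- The entrywise maximum norm `max_{i,j} |M i j|`. -/
def maxNorm {p : ℕ} (M : Matrix (Fin p) (Fin p) ℝ) : ℝ :=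
  ⨆ i, ⨆ j, |M i j|

/-- The largest Euclidean norm of a column. -/
def maxColNorm {p : ℕ} (M : Matrix (Fin p) (Fin p) ℝ) : ℝ :=
  ⨆ j, √(∑ i, M i j ^ 2)

/-- The Frobenius norm of the off-diagonal part, `√(∑_{i ≠ j} (M i j)²)`. -/
def offFrobNorm {p : ℕ} (M : Matrix (Fin p) (Fin p) ℝ) : ℝ :=
  √(∑ i, ∑ j, if i = j then 0 else M i j ^ 2)

/-- The error level `τ_∞`, up to the constant `C`. -/
def tauInf (C : ℝ) (n d p : ℕ) (S : Matrix (Fin p) (Fin p) ℝ) (σ : ℝ≥0) : ℝ :=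
  let L := Real.log p
  C * (√(L / n)
    + √(L / d) * maxColNorm S
    + L / d * (1 + p / d) * offFrobNorm S
    + L * √p / √(n * d)
    + p * L ^ (3 / 2 : ℝ) / (√n * d) * (1 + p / d)
    + √(p * L) / d
    + p * √L / (d : ℝ) ^ (3 / 2 : ℝ)
    + (σ : ℝ) ^ 2 * (1 + √(L / d)) * √(L / d) * (1 + max √((d : ℝ) / n) ((d : ℝ) / n)))

end

end IndirectCov

/-!
An off-diagonal entry of `T = Aᵀ ((1/n) ∑ₛ Y⁽ˢ⁾ Y⁽ˢ⁾ᵀ) A` is recovered by polarization from the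
quadratic forms `cᵀ T c` with `c = eᵢ ± eⱼ`. Conditionally on `A`, the projections `⟨A c, Y⁽ˢ⁾⟩` are
i.i.d. centred Gaussians, so `cᵀ T c` concentrates around their common variance
`cᵀ G S G c + σ² cᵀ G c`, where `G = Aᵀ A`. This leaves the bias `G S G - S`. Entrywise bounds on
`G - 1` and `G S - S` control the contribution of the rows `i` and `j` of `G c`. The other entries
of `G c` are scalar products of `A c` with columns of `A` independent of it, hence i.i.d. Gaussian
given `A c`, and the Hanson-Wright inequality applies to the quadratic form of `S` at this vector.
The mean of this form is of order `p / d`, but it nearly cancels between the two signs in the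
polarization. A union bound over the entries at confidence level `3 log p` concludes when
`3 ≤ p` and `log p ≤ d`; otherwise the asserted lower bound is nonpositive.
-/

namespace IndirectCov

section ChiSquare

lemma exp_neg_mul_inv_sqrt_one_sub_le {t : ℝ} (ht : |t| ≤ 1 / 4) :
    Real.exp (-t) * (√(1 - 2 * t))⁻¹ ≤ Real.exp (4 * t ^ 2) := by
  have hpos : 0 < 1 - 2 * t := by linarith [le_abs_self t]
  have habs : |2 * t| ≤ 1 / 2 := by rw [abs_mul, abs_two]; linarith
  have hlog := Real.abs_log_sub_add_sum_range_le (x := 2 * t) (by linarith) 1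
  simp only [Finset.sum_range_one, zero_add, pow_one, Nat.cast_zero, div_one, Nat.reduceAdd,
    sq_abs] at hlog
  have hrem : (2 * t) ^ 2 / (1 - |2 * t|) ≤ 8 * t ^ 2 := by
    rw [div_le_iff₀ (by linarith)]
    nlinarith [sq_nonneg t]
  have hlow : -(8 * t ^ 2) ≤ 2 * t + Real.log (1 - 2 * t) := (abs_le.mp (hlog.trans hrem)).1
  rw [Real.sqrt_eq_rpow, ← Real.rpow_neg hpos.le, Real.rpow_def_of_pos hpos, ← Real.exp_add,
    Real.exp_le_exp]
  linarith

/-- For `1 / 2 ≤ t` both sides are `0`, by the conventions for divergent integrals, `√` and `⁻¹`. -/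
lemma integral_exp_mul_sq_gaussianReal (t : ℝ) :
    ∫ z, Real.exp (t * z ^ 2) ∂(gaussianReal 0 1) = (√(1 - 2 * t))⁻¹ := by
  have hdensity (z : ℝ) : gaussianPDFReal 0 1 z • Real.exp (t * z ^ 2)
      = (√(2 * Real.pi))⁻¹ * Real.exp (-((1 - 2 * t) / 2) * z ^ 2) := by
    simp only [gaussianPDFReal, NNReal.coe_one, mul_one, sub_zero, smul_eq_mul]
    rw [mul_assoc, ← Real.exp_add]
    ring_nf
  rw [integral_gaussianReal_eq_integral_smul one_ne_zero]
  simp_rw [hdensity]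
  rw [integral_const_mul, integral_gaussian, ← Real.sqrt_inv, ← Real.sqrt_inv,
    ← Real.sqrt_mul (by positivity)]
  congr 1
  field_simp

lemma integrable_exp_mul_sq_gaussianReal {t : ℝ} (ht : t < 1 / 2) :
    Integrable (fun z => Real.exp (t * z ^ 2)) (gaussianReal 0 1) := by
  have hpos : 0 < 1 - 2 * t := by linarith
  refine .of_integral_ne_zero ?_
  rw [integral_exp_mul_sq_gaussianReal]
  positivity

lemma exp_mul_sq_sub_one (t z : ℝ) :
    Real.exp (t * (z ^ 2 - 1)) = Real.exp (-t) * Real.exp (t * z ^ 2) := by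
  rw [← Real.exp_add]
  ring_nf

lemma mgf_sq_sub_one_gaussianReal_le {t : ℝ} (ht : |t| ≤ 1 / 4) :
    mgf (fun z => z ^ 2 - 1) (gaussianReal 0 1) t ≤ Real.exp (4 * t ^ 2) := by
  simp_rw [mgf, exp_mul_sq_sub_one]
  rw [integral_const_mul, integral_exp_mul_sq_gaussianReal]
  exact exp_neg_mul_inv_sqrt_one_sub_le ht

variable {ι : Type*} [Fintype ι]

/-- The law of a vector indexed by `ι` whose entries are i.i.d. `N(0, v)`. -/
noncomputable abbrev iidGaussian (ι : Type*) [Fintype ι] (v : ℝ≥0) : Measure (ι → ℝ) :=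
  Measure.pi fun _ : ι => gaussianReal 0 v

lemma measureReal_le_sum_mul_sq_sub_one {l : ι → ℝ} {t : ℝ} (ht₀ : 0 ≤ t)
    (ht : ∀ k, t * |l k| ≤ 1 / 4) (x : ℝ) :
    (iidGaussian ι 1).real {z | x ≤ ∑ k, l k * (z k ^ 2 - 1)}
      ≤ Real.exp (-t * x + 4 * t ^ 2 * ∑ k, l k ^ 2) := by
  have htl (k : ι) : |t * l k| ≤ 1 / 4 := by rw [abs_mul, abs_of_nonneg ht₀]; exact ht k
  have hexp (z : ι → ℝ) : Real.exp (t * ∑ k, l k * (z k ^ 2 - 1))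
      = ∏ k, Real.exp (t * l k * (z k ^ 2 - 1)) := by
    rw [← Real.exp_sum, Finset.mul_sum]
    simp_rw [mul_assoc]
  have hint : Integrable (fun z => Real.exp (t * ∑ k, l k * (z k ^ 2 - 1))) (iidGaussian ι 1) := by
    simp_rw [hexp]
    refine .fintype_prod (f := fun k z => Real.exp (t * l k * (z ^ 2 - 1))) fun k => ?_
    simp_rw [exp_mul_sq_sub_one]
    exact (integrable_exp_mul_sq_gaussianReal (by linarith [(abs_le.mp (htl k)).2])).const_mul _
  have hmgf : mgf (fun z => ∑ k, l k * (z k ^ 2 - 1)) (iidGaussian ι 1) t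
      ≤ Real.exp (4 * t ^ 2 * ∑ k, l k ^ 2) := by
    simp_rw [mgf, hexp]
    rw [integral_fintype_prod_eq_prod (fun k (z : ℝ) => Real.exp (t * l k * (z ^ 2 - 1))),
      Finset.mul_sum, Real.exp_sum]
    refine Finset.prod_le_prod (fun k _ => integral_nonneg fun z => (Real.exp_pos _).le) fun k _ =>
      (mgf_sq_sub_one_gaussianReal_le (htl k)).trans_eq ?_
    ring_nf
  calc (iidGaussian ι 1).real {z | x ≤ ∑ k, l k * (z k ^ 2 - 1)}
      ≤ Real.exp (-t * x) * mgf (fun z => ∑ k, l k * (z k ^ 2 - 1)) (iidGaussian ι 1) t :=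
        measure_ge_le_exp_mul_mgf x ht₀ hint
    _ ≤ Real.exp (-t * x) * Real.exp (4 * t ^ 2 * ∑ k, l k ^ 2) := by gcongr
    _ = Real.exp (-t * x + 4 * t ^ 2 * ∑ k, l k ^ 2) := (Real.exp_add _ _).symm

lemma exists_chernoff_parameter {F Λ u : ℝ} (hF : 0 < F) (hΛ : 0 ≤ Λ) (hu : 0 ≤ u) :
    ∃ t, 0 ≤ t ∧ t * Λ ≤ 1 / 4 ∧
      -t * (4 * √(u * F ^ 2) + 8 * u * Λ) + 4 * t ^ 2 * F ^ 2 ≤ -u := by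
  set r := √u
  have hr : 0 ≤ r := Real.sqrt_nonneg u
  have hur : u = r ^ 2 := (Real.sq_sqrt hu).symm
  have hD : 0 < 2 * F + 4 * r * Λ := by positivity
  have hlinear : r / (2 * F + 4 * r * Λ) * (4 * √(u * F ^ 2) + 8 * u * Λ) = 2 * u := by
    rw [hur, ← mul_pow, Real.sqrt_sq (by positivity), div_mul_eq_mul_div, div_eq_iff hD.ne']
    ring
  have hquadratic : 4 * (r / (2 * F + 4 * r * Λ)) ^ 2 * F ^ 2 ≤ u := by
    rw [hur, div_pow, mul_div_assoc', div_mul_eq_mul_div, div_le_iff₀ (by positivity)]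
    have : (2 * F) ^ 2 ≤ (2 * F + 4 * r * Λ) ^ 2 := by gcongr; linarith [mul_nonneg hr hΛ]
    nlinarith [mul_le_mul_of_nonneg_left this (sq_nonneg r)]
  refine ⟨r / (2 * F + 4 * r * Λ), by positivity, ?_, by linarith⟩
  rw [div_mul_eq_mul_div, div_le_iff₀ hD]
  linarith

lemma measureReal_lt_abs_sum_mul_sq_sub_one_le {l : ι → ℝ} {Λ u : ℝ} (hΛ : 0 ≤ Λ)
    (hl : ∀ k, |l k| ≤ Λ) (hu : 0 ≤ u) :
    (iidGaussian ι 1).real {z | 4 * √(u * ∑ k, l k ^ 2) + 8 * u * Λ < |∑ k, l k * (z k ^ 2 - 1)|}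
      ≤ 2 * Real.exp (-u) := by
  have hF : 0 ≤ ∑ k, l k ^ 2 := Finset.sum_nonneg fun k _ => sq_nonneg (l k)
  rcases hF.eq_or_lt with hzero | hpos
  · have hl₀ : l = 0 := funext fun k => by
      simpa using (Finset.sum_eq_zero_iff_of_nonneg fun k _ => sq_nonneg (l k)).mp hzero.symm k
        (Finset.mem_univ k)
    have hempty : {z : ι → ℝ |
        4 * √(u * ∑ k, l k ^ 2) + 8 * u * Λ < |∑ k, l k * (z k ^ 2 - 1)|} = ∅ := by
      simpa [Set.eq_empty_iff_forall_notMem, hl₀] using mul_nonneg (mul_nonneg (by norm_num) hu) hΛ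
    rw [hempty, measureReal_empty]
    positivity
  obtain ⟨t, ht₀, htΛ, hexponent⟩ := exists_chernoff_parameter (Real.sqrt_pos.mpr hpos) hΛ hu
  rw [Real.sq_sqrt hF] at hexponent
  have htl (k : ι) : t * |l k| ≤ 1 / 4 := (mul_le_mul_of_nonneg_left (hl k) ht₀).trans htΛ
  set x := 4 * √(u * ∑ k, l k ^ 2) + 8 * u * Λ
  have hupper := measureReal_le_sum_mul_sq_sub_one ht₀ htl x
  have hlower := measureReal_le_sum_mul_sq_sub_one (l := -l) ht₀ (by simpa using htl) x
  simp only [Pi.neg_apply, neg_sq, neg_mul, Finset.sum_neg_distrib] at hlower hupper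
  have hsub : {z : ι → ℝ | x < |∑ k, l k * (z k ^ 2 - 1)|} ⊆
      {z | x ≤ ∑ k, l k * (z k ^ 2 - 1)} ∪ {z | x ≤ -∑ k, l k * (z k ^ 2 - 1)} := by
    intro z hz
    rcases lt_abs.mp hz.out with h | h
    exacts [.inl h.le, .inr h.le]
  have hexp := Real.exp_le_exp.mpr (neg_mul t x ▸ hexponent)
  linarith [measureReal_mono hsub (μ := iidGaussian ι 1),
    measureReal_union_le (μ := iidGaussian ι 1) {z : ι → ℝ | x ≤ ∑ k, l k * (z k ^ 2 - 1)}
      {z | x ≤ -∑ k, l k * (z k ^ 2 - 1)}]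

end ChiSquare

section QuadraticForms

variable {ι : Type*} [Fintype ι]

lemma measurePreserving_sqrt_smul_iidGaussian (v : ℝ≥0) :
    MeasurePreserving (fun z => √(v : ℝ) • z) (iidGaussian ι 1) (iidGaussian ι v) := by
  have hcoord : MeasurePreserving (fun z => √(v : ℝ) * z) (gaussianReal 0 1)
      (gaussianReal 0 v) := by
    refine ⟨by fun_prop, ?_⟩
    rw [gaussianReal_map_const_mul]
    congr 1
    · simp
    · ext; simp
  exact measurePreserving_pi _ _ fun _ => hcoord

lemma measurePreserving_orthonormalBasis_iidGaussian
    (b : OrthonormalBasis ι ℝ (EuclideanSpace ℝ ι)) :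
    MeasurePreserving (fun w : ι → ℝ => (∑ k, w k • b k).ofLp) (iidGaussian ι 1)
      (iidGaussian ι 1) := by
  have hbasis : MeasurePreserving (fun w : ι → ℝ => ∑ k, w k • b k) (iidGaussian ι 1)
      (stdGaussian (EuclideanSpace ℝ ι)) :=
    ⟨by fun_prop, (stdGaussian_eq_map_pi_orthonormalBasis b).symm⟩
  have hcoord : MeasurePreserving (MeasurableEquiv.toLp 2 (ι → ℝ)) (iidGaussian ι 1)
      (stdGaussian (EuclideanSpace ℝ ι)) :=
    ⟨by fun_prop, map_pi_eq_stdGaussian⟩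
  exact (hcoord.symm _).comp hbasis

lemma dotProduct_eq_inner_toLp (x y : EuclideanSpace ℝ ι) : x.ofLp ⬝ᵥ y.ofLp = inner ℝ x y := by
  simp [PiLp.inner_apply, dotProduct, mul_comm]

section Diagonalization

variable [DecidableEq ι]

lemma sum_sq_eigenvalues {M : Matrix ι ι ℝ} (hM : M.IsHermitian) :
    ∑ k, hM.eigenvalues k ^ 2 = ∑ i, ∑ j, M i j ^ 2 := by
  have htrace : (M * M).trace = ∑ i, ∑ j, M i j ^ 2 := by
    simp only [Matrix.trace, Matrix.diag, Matrix.mul_apply]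
    refine Finset.sum_congr rfl fun i _ => Finset.sum_congr rfl fun j _ => ?_
    rw [sq, ← hM.apply i j, star_trivial]
  rw [← htrace]
  conv_rhs => rw [hM.spectral_theorem, ← map_mul, Matrix.diagonal_mul_diagonal]
  rw [Unitary.conjStarAlgAut_apply, Matrix.trace_mul_cycle, Unitary.coe_star_mul_self, one_mul,
    Matrix.trace_diagonal]
  simp [sq]

lemma quadForm_sum_smul_eigenvectorBasis {M : Matrix ι ι ℝ} (hM : M.IsHermitian) (w : ι → ℝ) :
    (∑ k, w k • hM.eigenvectorBasis k).ofLp ⬝ᵥ M *ᵥ (∑ k, w k • hM.eigenvectorBasis k).ofLp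
      = ∑ k, hM.eigenvalues k * w k ^ 2 := by
  have hmulVec : M *ᵥ (∑ k, w k • hM.eigenvectorBasis k).ofLp
      = (∑ k, (hM.eigenvalues k * w k) • hM.eigenvectorBasis k).ofLp := by
    simp only [WithLp.ofLp_sum, WithLp.ofLp_smul, Matrix.mulVec_sum, Matrix.mulVec_smul,
      hM.mulVec_eigenvectorBasis, smul_smul, mul_comm]
  rw [hmulVec, dotProduct_eq_inner_toLp, hM.eigenvectorBasis.orthonormal.inner_sum]
  exact Finset.sum_congr rfl fun k _ => by rw [conj_trivial]; ring

lemma abs_eigenvalues_le {M : Matrix ι ι ℝ} (hM : M.IsHermitian) {Λ : ℝ}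
    (hΛ : ∀ x, |x ⬝ᵥ M *ᵥ x| ≤ Λ * (x ⬝ᵥ x)) (k : ι) : |hM.eigenvalues k| ≤ Λ := by
  have hunit : (hM.eigenvectorBasis k).ofLp ⬝ᵥ (hM.eigenvectorBasis k).ofLp = 1 := by
    rw [dotProduct_eq_inner_toLp, real_inner_self_eq_norm_sq, hM.eigenvectorBasis.norm_eq_one,
      one_pow]
  simpa [hM.mulVec_eigenvectorBasis, hunit] using hΛ (hM.eigenvectorBasis k).ofLp

end Diagonalization

lemma measureReal_lt_abs_quadForm_sub_trace_le_of_one {M : Matrix ι ι ℝ} (hM : M.IsHermitian)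
    {Λ u : ℝ} (hΛ₀ : 0 ≤ Λ) (hΛ : ∀ x, |x ⬝ᵥ M *ᵥ x| ≤ Λ * (x ⬝ᵥ x)) (hu : 0 ≤ u) :
    (iidGaussian ι 1).real
        {z | 4 * √(u * ∑ i, ∑ j, M i j ^ 2) + 8 * u * Λ < |z ⬝ᵥ M *ᵥ z - M.trace|}
      ≤ 2 * Real.exp (-u) := by
  classical
  have htrace : M.trace = ∑ k, hM.eigenvalues k := by simpa using hM.trace_eq_sum_eigenvalues
  have hs : MeasurableSet
      {z | 4 * √(u * ∑ i, ∑ j, M i j ^ 2) + 8 * u * Λ < |z ⬝ᵥ M *ᵥ z - M.trace|} :=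
    (isOpen_lt (by fun_prop) (by fun_prop)).measurableSet
  rw [← (measurePreserving_orthonormalBasis_iidGaussian hM.eigenvectorBasis).measureReal_preimage
    hs.nullMeasurableSet]
  simpa only [Set.preimage_ofPred_eq, quadForm_sum_smul_eigenvectorBasis, htrace,
    ← sum_sq_eigenvalues hM, mul_sub, mul_one, Finset.sum_sub_distrib]
    using measureReal_lt_abs_sum_mul_sq_sub_one_le hΛ₀ (abs_eigenvalues_le hM hΛ) hu

theorem hanson_wright {M : Matrix ι ι ℝ} (hM : M.IsHermitian)
    {Λ u : ℝ} (hΛ₀ : 0 ≤ Λ) (hΛ : ∀ x, |x ⬝ᵥ M *ᵥ x| ≤ Λ * (x ⬝ᵥ x)) (hu : 0 ≤ u) (v : ℝ≥0) :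
    (iidGaussian ι v).real {z | v * (4 * √(u * ∑ i, ∑ j, M i j ^ 2) + 8 * u * Λ) <
        |z ⬝ᵥ M *ᵥ z - v * M.trace|}
      ≤ 2 * Real.exp (-u) := by
  rw [← (measurePreserving_sqrt_smul_iidGaussian v).measureReal_preimage
    (isOpen_lt (by fun_prop) (by fun_prop)).measurableSet.nullMeasurableSet]
  refine (measureReal_mono fun z hz => ?_).trans
    (measureReal_lt_abs_quadForm_sub_trace_le_of_one hM hΛ₀ hΛ hu)
  have hscale : (√(v : ℝ) • z) ⬝ᵥ M *ᵥ (√(v : ℝ) • z) - v * M.trace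
      = v * (z ⬝ᵥ M *ᵥ z - M.trace) := by
    rw [Matrix.mulVec_smul, smul_dotProduct, dotProduct_smul, smul_smul,
      Real.mul_self_sqrt v.coe_nonneg, smul_eq_mul, mul_sub]
  rw [Set.mem_preimage, Set.mem_ofPred_eq, hscale, abs_mul, abs_of_nonneg v.coe_nonneg] at hz
  exact lt_of_mul_lt_mul_left hz v.coe_nonneg

/-- Relative deviation, at confidence level `u`, of the squared norm of a Gaussian vector of
dimension `N` from its mean. -/
noncomputable def relDev (N u : ℝ) : ℝ := 4 * √(u / N) + 8 * u / N

lemma relDev_nonneg {N u : ℝ} (hN : 0 ≤ N) (hu : 0 ≤ u) : 0 ≤ relDev N u := by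
  unfold relDev; positivity

lemma measureReal_lt_abs_normSq_sub_le [Nonempty ι] {u : ℝ} (hu : 0 ≤ u) (v : ℝ≥0) :
    (iidGaussian ι v).real {z | relDev (Fintype.card ι) u * (Fintype.card ι * v) <
        |z ⬝ᵥ z - Fintype.card ι * v|}
      ≤ 2 * Real.exp (-u) := by
  classical
  have hfrob : ∑ i : ι, ∑ j : ι, (1 : Matrix ι ι ℝ) i j ^ 2 = Fintype.card ι := by
    simp [Matrix.one_apply]
  have hsqrt : √(u * Fintype.card ι) = √(u / Fintype.card ι) * Fintype.card ι := by
    rw [Real.sqrt_div hu, div_mul_eq_mul_div, Real.sqrt_mul hu, mul_div_assoc, Real.div_sqrt]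
  have hdev : relDev (Fintype.card ι) u * (Fintype.card ι * v)
      = v * (4 * √(u * Fintype.card ι) + 8 * u * 1) := by
    rw [relDev, hsqrt]
    field_simp
  have hone (x : ι → ℝ) : |x ⬝ᵥ (1 : Matrix ι ι ℝ) *ᵥ x| ≤ 1 * (x ⬝ᵥ x) := by
    rw [Matrix.one_mulVec, one_mul, abs_of_nonneg (Finset.sum_nonneg fun i _ => mul_self_nonneg _)]
  have h := hanson_wright Matrix.isHermitian_one zero_le_one hone hu v
  simp only [hfrob, Matrix.one_mulVec, Matrix.trace_one] at h
  simpa only [hdev, mul_comm (v : ℝ) (Fintype.card ι)] using h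

end QuadraticForms

section LinearImages

variable {ι κ : Type*} [Fintype ι] [Fintype κ]

/-- The law of an `ι × κ` matrix whose entries are i.i.d. `N(0, v)`. -/
noncomputable abbrev iidGaussianMatrix (ι κ : Type*) [Fintype ι] [Fintype κ] (v : ℝ≥0) :
    Measure (ι → κ → ℝ) :=
  Measure.pi fun _ : ι => iidGaussian κ v

lemma measurePreserving_dotProduct_multivariateGaussian [DecidableEq ι] {S : Matrix ι ι ℝ}
    (hS : S.PosSemidef) (c : ι → ℝ) :
    MeasurePreserving (fun x : EuclideanSpace ℝ ι => c ⬝ᵥ x.ofLp) (multivariateGaussian 0 S)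
      (gaussianReal 0 (c ⬝ᵥ S *ᵥ c).toNNReal) := by
  have hinner : (fun x : EuclideanSpace ℝ ι => c ⬝ᵥ x.ofLp) = innerSL ℝ (WithLp.toLp 2 c) := by
    ext x
    simp [PiLp.inner_apply, dotProduct, mul_comm]
  have hvar : Var[innerSL ℝ (WithLp.toLp 2 c); multivariateGaussian 0 S] = c ⬝ᵥ S *ᵥ c := by
    rw [← covariance_self (by fun_prop)]
    exact (covarianceBilin_apply_eq_cov IsGaussian.memLp_two_id _ _).symm.trans
      (covarianceBilin_multivariateGaussian hS _ _)
  refine ⟨by fun_prop, ?_⟩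
  rw [hinner, IsGaussian.map_eq_gaussianReal, hvar,
    ContinuousLinearMap.integral_comp_id_comm IsGaussian.integrable_id,
    integral_id_multivariateGaussian, map_zero]

lemma measurePreserving_dotProduct_iidGaussian (v : ℝ≥0) (c : ι → ℝ) :
    MeasurePreserving (fun x => c ⬝ᵥ x) (iidGaussian ι v)
      (gaussianReal 0 ((c ⬝ᵥ c).toNNReal * v)) := by
  classical
  have hstd : MeasurePreserving (WithLp.toLp 2) (iidGaussian ι 1)
      (multivariateGaussian (0 : EuclideanSpace ℝ ι) 1) :=
    ⟨by fun_prop, map_pi_eq_stdGaussian.trans multivariateGaussian_zero_one.symm⟩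
  have hscaled := (measurePreserving_dotProduct_multivariateGaussian .one (√(v : ℝ) • c)).comp hstd
  have hvar : ((√(v : ℝ) • c) ⬝ᵥ (1 : Matrix ι ι ℝ) *ᵥ (√(v : ℝ) • c)).toNNReal
      = (c ⬝ᵥ c).toNNReal * v := by
    rw [Matrix.one_mulVec, smul_dotProduct, dotProduct_smul, smul_smul,
      Real.mul_self_sqrt v.coe_nonneg, smul_eq_mul, Real.toNNReal_mul v.coe_nonneg,
      Real.toNNReal_coe, mul_comm]
  refine ⟨by fun_prop, ?_⟩
  rw [← (measurePreserving_sqrt_smul_iidGaussian v).map_eq,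
    Measure.map_map (by fun_prop) (by fun_prop), ← hvar, ← hscaled.map_eq]
  congr 1
  ext z
  simp [smul_dotProduct, dotProduct_smul]

lemma measurePreserving_swap_pi {α : Type*} [MeasurableSpace α] (μ : Measure α)
    [IsProbabilityMeasure μ] :
    MeasurePreserving (fun (A : ι → κ → α) k i => A i k)
      (Measure.pi fun _ => Measure.pi fun _ => μ) (Measure.pi fun _ => Measure.pi fun _ => μ) := by
  refine ⟨by fun_prop, (Measure.pi_eq_generateFrom (fun _ => generateFrom_pi)
    (fun _ => isPiSystem_pi)
    (fun _ => Measure.FiniteSpanningSetsIn.pi fun _ => μ.toFiniteSpanningSetsIn) ?_).symm⟩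
  intro s hs
  choose t ht hts using hs
  obtain rfl : (fun k => Set.univ.pi (t k)) = s := funext hts
  have hmeas : ∀ k i, MeasurableSet (t k i) := fun k i => ht k i (Set.mem_univ i)
  have hpreimage : (fun (A : ι → κ → α) k i => A i k) ⁻¹' Set.univ.pi (fun k => Set.univ.pi (t k))
      = Set.univ.pi fun i => Set.univ.pi fun k => t k i := by
    ext A
    simpa only [Set.mem_preimage, Set.mem_univ_pi] using forall_comm
  rw [Measure.map_apply (by fun_prop)
    (MeasurableSet.univ_pi fun k => MeasurableSet.univ_pi (hmeas k)), hpreimage]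
  simp_rw [Measure.pi_pi]
  exact Finset.prod_comm

lemma measurePreserving_mulVec_iidGaussianMatrix (v : ℝ≥0) (c : κ → ℝ) :
    MeasurePreserving (fun A => Matrix.of A *ᵥ c) (iidGaussianMatrix ι κ v)
      (iidGaussian ι ((c ⬝ᵥ c).toNNReal * v)) := by
  convert measurePreserving_pi (fun _ : ι => iidGaussian κ v) _
    (fun _ => measurePreserving_dotProduct_iidGaussian v c) using 1
  ext A i
  exact dotProduct_comm _ _

lemma measurePreserving_vecMul_iidGaussianMatrix (v : ℝ≥0) (b : ι → ℝ) :
    MeasurePreserving (fun A => b ᵥ* Matrix.of A) (iidGaussianMatrix ι κ v)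
      (iidGaussian κ ((b ⬝ᵥ b).toNNReal * v)) :=
  (measurePreserving_pi (fun _ : κ => iidGaussian ι v) _
    (fun _ => measurePreserving_dotProduct_iidGaussian v b)).comp (measurePreserving_swap_pi _)

lemma measurePreserving_pi_prod {α β γ : Type*} [MeasurableSpace α]
    [MeasurableSpace β] [MeasurableSpace γ] {μ : ι → Measure α} {ν : ι → Measure β}
    {ρ : ι → Measure γ} [∀ i, SigmaFinite (μ i)] [∀ i, SigmaFinite (ν i)] [∀ i, SigmaFinite (ρ i)]
    {f : ι → α × β → γ} (hf : ∀ i, MeasurePreserving (f i) ((μ i).prod (ν i)) (ρ i)) :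
    MeasurePreserving (fun q : (ι → α) × (ι → β) => fun i => f i (q.1 i, q.2 i))
      ((Measure.pi μ).prod (Measure.pi ν)) (Measure.pi ρ) :=
  (measurePreserving_pi _ _ hf).comp
    ((measurePreserving_arrowProdEquivProdArrow α β ι μ ν).symm _)

lemma prod_measureReal_le_of_forall {α β : Type*} [MeasurableSpace α] [MeasurableSpace β]
    {μ : Measure α} {ν : Measure β} [IsProbabilityMeasure μ] [IsProbabilityMeasure ν]
    {s : Set (α × β)} (hs : MeasurableSet s) {δ : ℝ}
    (h : ∀ x, ν.real (Prod.mk x ⁻¹' s) ≤ δ) : (μ.prod ν).real s ≤ δ := by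
  obtain ⟨x₀⟩ := μ.nonempty_of_neZero
  have hδ : 0 ≤ δ := measureReal_nonneg.trans (h x₀)
  rw [measureReal_def, Measure.prod_apply hs]
  refine ENNReal.toReal_le_of_le_ofReal hδ ?_
  calc ∫⁻ x, ν (Prod.mk x ⁻¹' s) ∂μ ≤ ∫⁻ _, ENNReal.ofReal δ ∂μ :=
        lintegral_mono fun x => (ENNReal.le_ofReal_iff_toReal_le (measure_ne_top _ _) hδ).mpr (h x)
    _ = ENNReal.ofReal δ := by simp

end LinearImages

section Decoupling

variable {ι κ : Type*} {U : Set κ}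

@[fun_prop]
lemma continuous_indicator_vec : Continuous fun x : κ → ℝ => U.indicator x := by
  refine continuous_pi fun k => ?_
  by_cases hk : k ∈ U <;> simp only [Set.indicator, hk, if_true, if_false] <;> fun_prop

variable [Fintype ι] [Fintype κ]

lemma measurePreserving_resample_columns [DecidablePred (· ∈ U)] (μ : Measure ℝ)
    [IsProbabilityMeasure μ] :
    MeasurePreserving
      (fun q : (ι → κ → ℝ) × (ι → κ → ℝ) => fun i => U.piecewise (q.2 i) (q.1 i))
      ((Measure.pi fun _ => Measure.pi fun _ => μ).prod (Measure.pi fun _ => Measure.pi fun _ => μ))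
      (Measure.pi fun _ => Measure.pi fun _ => μ) := by
  refine measurePreserving_pi_prod
    (f := fun _ (q : (κ → ℝ) × (κ → ℝ)) => U.piecewise q.2 q.1) fun _ => ?_
  refine measurePreserving_pi_prod (f := fun k (q : ℝ × ℝ) => if k ∈ U then q.2 else q.1)
    fun k => ?_
  by_cases hk : k ∈ U
  · simpa [hk] using measurePreserving_snd (μ := μ) (ν := μ)
  · simpa [hk] using measurePreserving_fst (μ := μ) (ν := μ)

/-- The columns of `A` in `U` are independent of `A c`, so conditionally on `b = A c` the entries
of `Aᵀ A c` in `U` are i.i.d. Gaussian of variance proportional to `|b|²`. -/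
lemma measureReal_mulVec_vecMul_le_of_forall {c : κ → ℝ} (hc : ∀ k ∈ U, c k = 0) (v : ℝ≥0)
    {s : Set ((ι → ℝ) × (κ → ℝ))} (hs : MeasurableSet s) {δ : ℝ}
    (h : ∀ b, (iidGaussian κ ((b ⬝ᵥ b).toNNReal * v)).real {x | (b, U.indicator x) ∈ s} ≤ δ) :
    (iidGaussianMatrix ι κ v).real
      {A | (Matrix.of A *ᵥ c, U.indicator ((Matrix.of A *ᵥ c) ᵥ* Matrix.of A)) ∈ s} ≤ δ := by
  classical
  have hmeas : MeasurableSet {q : (ι → κ → ℝ) × (ι → κ → ℝ) |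
      (Matrix.of q.1 *ᵥ c, U.indicator ((Matrix.of q.1 *ᵥ c) ᵥ* Matrix.of q.2)) ∈ s} :=
    (Continuous.measurable (by fun_prop)) hs
  have hmeas' : MeasurableSet {A : ι → κ → ℝ |
      (Matrix.of A *ᵥ c, U.indicator ((Matrix.of A *ᵥ c) ᵥ* Matrix.of A)) ∈ s} :=
    (Continuous.measurable (by fun_prop)) hs
  have hmulVec (A A' : ι → κ → ℝ) :
      Matrix.of (fun i => U.piecewise (A' i) (A i)) *ᵥ c = Matrix.of A *ᵥ c := by
    ext i
    refine Finset.sum_congr rfl fun k _ => ?_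
    by_cases hk : k ∈ U <;> simp [hk, hc]
  have hvecMul (b : ι → ℝ) (A A' : ι → κ → ℝ) :
      U.indicator (b ᵥ* Matrix.of (fun i => U.piecewise (A' i) (A i)))
        = U.indicator (b ᵥ* Matrix.of A') := by
    ext k
    by_cases hk : k ∈ U <;> simp [hk, Matrix.vecMul, dotProduct]
  rw [← (measurePreserving_resample_columns (U := U) (gaussianReal 0 v)).measureReal_preimage
    hmeas'.nullMeasurableSet]
  simp only [Set.preimage_ofPred_eq, hmulVec, hvecMul]
  refine prod_measureReal_le_of_forall hmeas fun A => ?_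
  refine le_of_eq_of_le ?_ (h (Matrix.of A *ᵥ c))
  rw [← (measurePreserving_vecMul_iidGaussianMatrix v (Matrix.of A *ᵥ c)).measureReal_preimage]
  · rfl
  · exact ((Continuous.measurable (by fun_prop)) hs).nullMeasurableSet

end Decoupling

section Sensing

variable {ι κ : Type*} [Fintype ι] [Fintype κ]

lemma indicator_eq_diagonal_mulVec [DecidableEq κ] (U : Set κ) (x : κ → ℝ) :
    U.indicator x = Matrix.diagonal (U.indicator 1) *ᵥ x := by
  ext k
  by_cases hk : k ∈ U <;> simp [hk, Matrix.mulVec_diagonal]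

lemma dotProduct_indicator_self_le (U : Set κ) (x : κ → ℝ) :
    U.indicator x ⬝ᵥ U.indicator x ≤ x ⬝ᵥ x := by
  refine Finset.sum_le_sum fun k _ => ?_
  by_cases hk : k ∈ U <;> simp [hk, mul_self_nonneg]

lemma hanson_wright_indicator {S : Matrix κ κ ℝ} (hS : S.IsHermitian) {Λ u : ℝ} (hΛ₀ : 0 ≤ Λ)
    (hΛ : ∀ x, |x ⬝ᵥ S *ᵥ x| ≤ Λ * (x ⬝ᵥ x)) (hu : 0 ≤ u) (v : ℝ≥0) (U : Set κ) :
    (iidGaussian κ v).real {x | v * (4 * √(u * ∑ k, ∑ l, S k l ^ 2) + 8 * u * Λ) <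
        |U.indicator x ⬝ᵥ S *ᵥ U.indicator x - v * ∑ k, U.indicator (fun k => S k k) k|}
      ≤ 2 * Real.exp (-u) := by
  classical
  set D : Matrix κ κ ℝ := Matrix.diagonal (U.indicator 1) with hD
  have hentry (k l : κ) : (D * S * D) k l = U.indicator 1 k * S k l * U.indicator 1 l := by
    rw [hD, Matrix.mul_diagonal, Matrix.diagonal_mul]
  have hquad (x : κ → ℝ) :
      U.indicator x ⬝ᵥ S *ᵥ U.indicator x = x ⬝ᵥ (D * S * D) *ᵥ x := by
    rw [indicator_eq_diagonal_mulVec, ← hD, ← Matrix.mulVec_mulVec, ← Matrix.mulVec_mulVec,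
      Matrix.dotProduct_mulVec x D, ← Matrix.mulVec_transpose, hD, Matrix.diagonal_transpose]
  have hherm : (D * S * D).IsHermitian := by
    ext k l
    rw [Matrix.conjTranspose_apply, hentry, hentry, star_trivial, ← hS.apply k l, star_trivial]
    ring
  have htrace : (D * S * D).trace = ∑ k, U.indicator (fun k => S k k) k := by
    refine Finset.sum_congr rfl fun k _ => ?_
    rw [Matrix.diag_apply, hentry]
    by_cases hk : k ∈ U <;> simp [hk]
  have hfrob : ∑ k, ∑ l, (D * S * D) k l ^ 2 ≤ ∑ k, ∑ l, S k l ^ 2 := by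
    refine Finset.sum_le_sum fun k _ => Finset.sum_le_sum fun l _ => ?_
    rw [hentry]
    by_cases hk : k ∈ U <;> by_cases hl : l ∈ U <;> simp [hk, hl, sq_nonneg]
  have hbound (x : κ → ℝ) : |x ⬝ᵥ (D * S * D) *ᵥ x| ≤ Λ * (x ⬝ᵥ x) := by
    rw [← hquad]
    exact (hΛ _).trans (mul_le_mul_of_nonneg_left (dotProduct_indicator_self_le U x) hΛ₀)
  refine (measureReal_mono fun x hx => ?_).trans (hanson_wright hherm hΛ₀ hbound hu v)
  simp only [Set.mem_ofPred_eq, hquad, ← htrace] at hx ⊢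
  exact lt_of_le_of_lt (by gcongr) hx

lemma measureReal_lt_abs_quadForm_indicator_gram_le {S : Matrix κ κ ℝ} (hS : S.IsHermitian)
    {Λ u : ℝ} (hΛ₀ : 0 ≤ Λ) (hΛ : ∀ x, |x ⬝ᵥ S *ᵥ x| ≤ Λ * (x ⬝ᵥ x)) (hu : 0 ≤ u) (v : ℝ≥0)
    {U : Set κ} {c : κ → ℝ} (hc : ∀ k ∈ U, c k = 0) :
    (iidGaussianMatrix ι κ v).real
        {A | (Matrix.of A *ᵥ c) ⬝ᵥ (Matrix.of A *ᵥ c) * v *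
              (4 * √(u * ∑ k, ∑ l, S k l ^ 2) + 8 * u * Λ) <
            |U.indicator ((Matrix.of A *ᵥ c) ᵥ* Matrix.of A) ⬝ᵥ
                S *ᵥ U.indicator ((Matrix.of A *ᵥ c) ᵥ* Matrix.of A)
              - (Matrix.of A *ᵥ c) ⬝ᵥ (Matrix.of A *ᵥ c) * v *
                  ∑ k, U.indicator (fun k => S k k) k|}
      ≤ 2 * Real.exp (-u) := by
  have hs : MeasurableSet {q : (ι → ℝ) × (κ → ℝ) |
      q.1 ⬝ᵥ q.1 * v * (4 * √(u * ∑ k, ∑ l, S k l ^ 2) + 8 * u * Λ) <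
        |q.2 ⬝ᵥ S *ᵥ q.2 - q.1 ⬝ᵥ q.1 * v * ∑ k, U.indicator (fun k => S k k) k|} :=
    (isOpen_lt (by fun_prop) (by fun_prop)).measurableSet
  refine measureReal_mulVec_vecMul_le_of_forall hc v hs fun b => ?_
  have hb : 0 ≤ b ⬝ᵥ b := dotProduct_star_self_nonneg b
  simpa only [Set.mem_ofPred_eq, NNReal.coe_mul, Real.coe_toNNReal _ hb] using
    hanson_wright_indicator hS hΛ₀ hΛ hu ((b ⬝ᵥ b).toNNReal * v) U

lemma dotProduct_add_self_add_dotProduct_sub_self (x y : κ → ℝ) :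
    (x + y) ⬝ᵥ (x + y) + (x - y) ⬝ᵥ (x - y) = 2 * (x ⬝ᵥ x) + 2 * (y ⬝ᵥ y) := by
  simp only [add_dotProduct, dotProduct_add, sub_dotProduct, dotProduct_sub]
  ring

lemma dotProduct_add_self_sub_dotProduct_sub_self (x y : κ → ℝ) :
    (x + y) ⬝ᵥ (x + y) - (x - y) ⬝ᵥ (x - y) = 4 * (x ⬝ᵥ y) := by
  simp only [add_dotProduct, dotProduct_add, sub_dotProduct, dotProduct_sub, dotProduct_comm y x]
  ring

lemma abs_dotProduct_mulVec_sub_le_of_polarization {M : Matrix ι κ ℝ} {x y : κ → ℝ} {a b r : ℝ}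
    (ha : 0 < a) (hb : 0 < b) (hr : 0 ≤ r) (hx : x ⬝ᵥ x ≤ a ^ 2) (hy : y ⬝ᵥ y ≤ b ^ 2)
    (h : ∀ c ∈ ({b • x + a • y, b • x - a • y} : Set (κ → ℝ)),
      |(M *ᵥ c) ⬝ᵥ (M *ᵥ c) - c ⬝ᵥ c| ≤ r * (c ⬝ᵥ c)) :
    |(M *ᵥ x) ⬝ᵥ (M *ᵥ y) - x ⬝ᵥ y| ≤ r * (a * b) := by
  set x' := b • x with hx'
  set y' := a • y with hy'
  set dev : (κ → ℝ) → ℝ := fun c => (M *ᵥ c) ⬝ᵥ (M *ᵥ c) - c ⬝ᵥ c with hdev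
  have hpolar : dev (x' + y') - dev (x' - y')
      = 4 * (a * b) * ((M *ᵥ x) ⬝ᵥ (M *ᵥ y) - x ⬝ᵥ y) := by
    have himage := dotProduct_add_self_sub_dotProduct_sub_self (M *ᵥ x') (M *ᵥ y')
    have hsource := dotProduct_add_self_sub_dotProduct_sub_self x' y'
    simp only [hdev, Matrix.mulVec_add, Matrix.mulVec_sub]
    simp only [hx', hy', Matrix.mulVec_smul, smul_dotProduct, dotProduct_smul, smul_eq_mul]
      at himage hsource ⊢
    linear_combination himage - hsource
  have hnorms : (x' + y') ⬝ᵥ (x' + y') + (x' - y') ⬝ᵥ (x' - y') ≤ 4 * (a * b) ^ 2 := by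
    rw [dotProduct_add_self_add_dotProduct_sub_self]
    simp only [hx', hy', smul_dotProduct, dotProduct_smul, smul_eq_mul]
    nlinarith [mul_le_mul_of_nonneg_left hx (sq_nonneg b),
      mul_le_mul_of_nonneg_left hy (sq_nonneg a)]
  have hab : 0 < 4 * (a * b) := by positivity
  refine le_of_mul_le_mul_left ?_ hab
  calc 4 * (a * b) * |(M *ᵥ x) ⬝ᵥ (M *ᵥ y) - x ⬝ᵥ y|
      = |dev (x' + y') - dev (x' - y')| := by rw [hpolar, abs_mul, abs_of_pos hab]
    _ ≤ |dev (x' + y')| + |dev (x' - y')| := abs_sub _ _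
    _ ≤ r * ((x' + y') ⬝ᵥ (x' + y')) + r * ((x' - y') ⬝ᵥ (x' - y')) :=
      add_le_add (h _ (by simp)) (h _ (by simp))
    _ ≤ 4 * (a * b) * (r * (a * b)) := by nlinarith [mul_le_mul_of_nonneg_left hnorms hr]

variable [Nonempty ι] {u : ℝ}

lemma measureReal_lt_abs_normSq_mulVec_sub_le (hu : 0 ≤ u) (c : κ → ℝ) :
    (iidGaussianMatrix ι κ (Fintype.card ι : ℝ≥0)⁻¹).real
        {A | relDev (Fintype.card ι) u * (c ⬝ᵥ c) <
          |(Matrix.of A *ᵥ c) ⬝ᵥ (Matrix.of A *ᵥ c) - c ⬝ᵥ c|}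
      ≤ 2 * Real.exp (-u) := by
  have hcc : 0 ≤ c ⬝ᵥ c := dotProduct_star_self_nonneg c
  have hvar : (Fintype.card ι : ℝ) * ↑((c ⬝ᵥ c).toNNReal * (Fintype.card ι : ℝ≥0)⁻¹) = c ⬝ᵥ c := by
    rw [NNReal.coe_mul, Real.coe_toNNReal _ hcc, NNReal.coe_inv, NNReal.coe_natCast]
    field_simp
  have h := measureReal_lt_abs_normSq_sub_le (ι := ι) hu
    ((c ⬝ᵥ c).toNNReal * (Fintype.card ι : ℝ≥0)⁻¹)
  rwa [hvar, ← (measurePreserving_mulVec_iidGaussianMatrix _ c).measureReal_preimage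
    (isOpen_lt (by fun_prop) (by fun_prop)).measurableSet.nullMeasurableSet] at h

lemma measureReal_lt_abs_dotProduct_mulVec_sub_le (hu : 0 ≤ u) {x y : κ → ℝ} {a b : ℝ}
    (ha : 0 < a) (hb : 0 < b) (hx : x ⬝ᵥ x ≤ a ^ 2) (hy : y ⬝ᵥ y ≤ b ^ 2) :
    (iidGaussianMatrix ι κ (Fintype.card ι : ℝ≥0)⁻¹).real
        {A | relDev (Fintype.card ι) u * (a * b) <
          |(Matrix.of A *ᵥ x) ⬝ᵥ (Matrix.of A *ᵥ y) - x ⬝ᵥ y|}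
      ≤ 4 * Real.exp (-u) := by
  have hr : 0 ≤ relDev (Fintype.card ι) u := relDev_nonneg (Nat.cast_nonneg _) hu
  set bad : (κ → ℝ) → Set (ι → κ → ℝ) := fun c =>
    {A | relDev (Fintype.card ι) u * (c ⬝ᵥ c) <
      |(Matrix.of A *ᵥ c) ⬝ᵥ (Matrix.of A *ᵥ c) - c ⬝ᵥ c|} with hbad
  have hsub : {A : ι → κ → ℝ | relDev (Fintype.card ι) u * (a * b) <
      |(Matrix.of A *ᵥ x) ⬝ᵥ (Matrix.of A *ᵥ y) - x ⬝ᵥ y|} ⊆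
      bad (b • x + a • y) ∪ bad (b • x - a • y) := by
    intro A hA
    contrapose! hA
    simp only [hbad, Set.mem_union, Set.mem_ofPred_eq, not_or, not_lt] at hA ⊢
    refine abs_dotProduct_mulVec_sub_le_of_polarization ha hb hr hx hy ?_
    rintro c (rfl | rfl)
    exacts [hA.1, hA.2]
  calc _ ≤ _ := (measureReal_mono hsub).trans (measureReal_union_le _ _)
    _ ≤ 2 * Real.exp (-u) + 2 * Real.exp (-u) :=
      add_le_add (measureReal_lt_abs_normSq_mulVec_sub_le hu _)
        (measureReal_lt_abs_normSq_mulVec_sub_le hu _)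
    _ = 4 * Real.exp (-u) := by ring

end Sensing

section Observations

lemma measurePreserving_add_gaussianReal (v w : ℝ≥0) :
    MeasurePreserving (fun q : ℝ × ℝ => q.1 + q.2) ((gaussianReal 0 v).prod (gaussianReal 0 w))
      (gaussianReal 0 (v + w)) := by
  refine ⟨by fun_prop, ?_⟩
  simpa only [Measure.conv, add_zero] using
    gaussianReal_conv_gaussianReal (m₁ := 0) (m₂ := 0) (v₁ := v) (v₂ := w)

variable {n d p : ℕ}

/-- The law of the signals and the noise, the second factor of `modelLaw`. -/
noncomputable abbrev sampleLaw (n d p : ℕ) (S : Matrix (Fin p) (Fin p) ℝ) (σ : ℝ≥0) :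
    Measure ((Fin n → EuclideanSpace ℝ (Fin p)) × (Fin n → Fin d → ℝ)) :=
  (Measure.pi fun _ => multivariateGaussian 0 S).prod (iidGaussianMatrix (Fin n) (Fin d) (σ ^ 2))

lemma measurePreserving_dotProduct_obs {S : Matrix (Fin p) (Fin p) ℝ} (hS : S.PosSemidef)
    (σ : ℝ≥0) (A : Fin d → Fin p → ℝ) (b : Fin d → ℝ) :
    MeasurePreserving (fun q s => b ⬝ᵥ obs A q.1 q.2 s) (sampleLaw n d p S σ)
      (iidGaussian (Fin n) (((b ᵥ* Matrix.of A) ⬝ᵥ S *ᵥ (b ᵥ* Matrix.of A)).toNNReal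
        + (b ⬝ᵥ b).toNNReal * σ ^ 2)) := by
  convert measurePreserving_pi_prod (ι := Fin n) fun _ =>
    (measurePreserving_add_gaussianReal _ _).comp
      ((measurePreserving_dotProduct_multivariateGaussian hS (b ᵥ* Matrix.of A)).prod
        (measurePreserving_dotProduct_iidGaussian (σ ^ 2) b)) using 1
  ext q s
  simp only [obs, dotProduct_add, Matrix.dotProduct_mulVec, Function.comp_apply, Prod.map_fst,
    Prod.map_snd]

lemma dotProduct_empMoment_mulVec (Y : Fin n → Fin d → ℝ) (b : Fin d → ℝ) :
    b ⬝ᵥ empMoment Y *ᵥ b = (n : ℝ)⁻¹ * ((fun s => b ⬝ᵥ Y s) ⬝ᵥ fun s => b ⬝ᵥ Y s) := by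
  rw [empMoment, Matrix.smul_mulVec, dotProduct_smul, Matrix.sum_mulVec, dotProduct_sum,
    smul_eq_mul]
  congr 1
  refine Finset.sum_congr rfl fun s _ => ?_
  rw [Matrix.vecMulVec_mulVec, op_smul_eq_smul, dotProduct_smul, dotProduct_comm (Y s) b,
    smul_eq_mul]

lemma measureReal_lt_abs_quadForm_empMoment_sub_le [NeZero n] {S : Matrix (Fin p) (Fin p) ℝ}
    (hS : S.PosSemidef) (σ : ℝ≥0) (A : Fin d → Fin p → ℝ) (b : Fin d → ℝ) {u V : ℝ} (hu : 0 ≤ u)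
    (hV : (b ᵥ* Matrix.of A) ⬝ᵥ S *ᵥ (b ᵥ* Matrix.of A) + σ ^ 2 * (b ⬝ᵥ b) = V) :
    (sampleLaw n d p S σ).real
        {q | relDev n u * V < |b ⬝ᵥ empMoment (obs A q.1 q.2) *ᵥ b - V|}
      ≤ 2 * Real.exp (-u) := by
  have hn : (0 : ℝ) < n := Nat.cast_pos.mpr (NeZero.pos n)
  have hquad : 0 ≤ (b ᵥ* Matrix.of A) ⬝ᵥ S *ᵥ (b ᵥ* Matrix.of A) := hS.dotProduct_mulVec_nonneg _
  have hbb : 0 ≤ b ⬝ᵥ b := dotProduct_star_self_nonneg b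
  have hvar : ((((b ᵥ* Matrix.of A) ⬝ᵥ S *ᵥ (b ᵥ* Matrix.of A)).toNNReal
      + (b ⬝ᵥ b).toNNReal * σ ^ 2 : ℝ≥0) : ℝ) = V := by
    rw [NNReal.coe_add, NNReal.coe_mul, Real.coe_toNNReal _ hquad, Real.coe_toNNReal _ hbb,
      NNReal.coe_pow, ← hV, mul_comm (b ⬝ᵥ b)]
  have htail := measureReal_lt_abs_normSq_sub_le (ι := Fin n) hu
    (((b ᵥ* Matrix.of A) ⬝ᵥ S *ᵥ (b ᵥ* Matrix.of A)).toNNReal + (b ⬝ᵥ b).toNNReal * σ ^ 2)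
  rw [← (measurePreserving_dotProduct_obs hS σ A b).measureReal_preimage
    (isOpen_lt (by fun_prop) (by fun_prop)).measurableSet.nullMeasurableSet] at htail
  refine (measureReal_mono fun q hq => ?_).trans htail
  simp only [Set.mem_preimage, Set.mem_ofPred_eq, Fintype.card_fin, hvar,
    dotProduct_empMoment_mulVec] at hq ⊢
  set z := fun s => b ⬝ᵥ obs A q.1 q.2 s
  have hscale : z ⬝ᵥ z - n * V = n * ((n : ℝ)⁻¹ * (z ⬝ᵥ z) - V) := by field_simp
  rw [hscale, abs_mul, abs_of_pos hn, mul_left_comm]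
  exact mul_lt_mul_of_pos_left hq hn

end Observations

section CorrelationMatrices

lemma abs_dotProduct_mulVec_le_sqrt_sum_sq_mul {κ : Type*} [Fintype κ] (M : Matrix κ κ ℝ)
    (x : κ → ℝ) : |x ⬝ᵥ M *ᵥ x| ≤ √(∑ k, ∑ l, M k l ^ 2) * (x ⬝ᵥ x) := by
  have hexpand : x ⬝ᵥ M *ᵥ x = ∑ q : κ × κ, M q.1 q.2 * (x q.1 * x q.2) := by
    rw [Fintype.sum_prod_type]
    simp only [dotProduct, Matrix.mulVec, Finset.mul_sum]
    exact Finset.sum_congr rfl fun k _ => Finset.sum_congr rfl fun l _ => by ring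
  have hnorm : ∑ q : κ × κ, (x q.1 * x q.2) ^ 2 = (x ⬝ᵥ x) ^ 2 := by
    rw [Fintype.sum_prod_type, sq (x ⬝ᵥ x), dotProduct, Finset.sum_mul_sum]
    exact Finset.sum_congr rfl fun k _ => Finset.sum_congr rfl fun l _ => by ring
  have hxx : 0 ≤ x ⬝ᵥ x := dotProduct_star_self_nonneg x
  rw [hexpand]
  refine (Real.abs_le_sqrt (Finset.sum_mul_sq_le_sq_mul_sq _ _ _)).trans_eq ?_
  rw [hnorm, Real.sqrt_mul (by positivity), Real.sqrt_sq hxx, Fintype.sum_prod_type]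

variable {p : ℕ} {S : Matrix (Fin p) (Fin p) ℝ}

lemma offFrobNorm_eq_sqrt_sum_offDiag_sq (S : Matrix (Fin p) (Fin p) ℝ) :
    offFrobNorm S = √(∑ i, ∑ j, offDiag S i j ^ 2) := by
  simp only [offFrobNorm, offDiag, Matrix.of_apply, ite_pow, ne_eq, OfNat.ofNat_ne_zero,
    not_false_eq_true, zero_pow]

lemma one_add_offDiag (hdiag : ∀ i, S i i = 1) : 1 + offDiag S = S := by
  ext i j
  by_cases hij : i = j
  · simp [hij, offDiag, hdiag]
  · simp [hij, offDiag]

lemma abs_dotProduct_mulVec_le_one_add_offFrobNorm_mul (hdiag : ∀ i, S i i = 1) (x : Fin p → ℝ) :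
    |x ⬝ᵥ S *ᵥ x| ≤ (1 + offFrobNorm S) * (x ⬝ᵥ x) := by
  have hxx : 0 ≤ x ⬝ᵥ x := dotProduct_star_self_nonneg x
  calc |x ⬝ᵥ S *ᵥ x| = |x ⬝ᵥ x + x ⬝ᵥ offDiag S *ᵥ x| := by
        conv_lhs => rw [← one_add_offDiag hdiag, Matrix.add_mulVec, Matrix.one_mulVec,
          dotProduct_add]
    _ ≤ x ⬝ᵥ x + offFrobNorm S * (x ⬝ᵥ x) := by
        refine (abs_add_le _ _).trans (add_le_add (abs_of_nonneg hxx).le ?_)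
        rw [offFrobNorm_eq_sqrt_sum_offDiag_sq]
        exact abs_dotProduct_mulVec_le_sqrt_sum_sq_mul _ x
    _ = (1 + offFrobNorm S) * (x ⬝ᵥ x) := by ring

lemma sum_sq_eq_add_offFrobNorm_sq (hdiag : ∀ i, S i i = 1) :
    ∑ i, ∑ j, S i j ^ 2 = p + offFrobNorm S ^ 2 := by
  rw [offFrobNorm, Real.sq_sqrt (Finset.sum_nonneg fun i _ => Finset.sum_nonneg fun j _ => by
    split_ifs <;> positivity)]
  have hrow (i : Fin p) : ∑ j, S i j ^ 2 = 1 + ∑ j, if i = j then 0 else S i j ^ 2 := by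
    have hone : (1 : ℝ) = ∑ j, if i = j then 1 else 0 := by simp
    rw [hone, ← Finset.sum_add_distrib]
    refine Finset.sum_congr rfl fun j _ => ?_
    split_ifs with hij
    · simp [← hij, hdiag]
    · simp
  simp [hrow, Finset.sum_add_distrib]

lemma col_dotProduct_col_le_maxColNorm_sq (S : Matrix (Fin p) (Fin p) ℝ) (j : Fin p) :
    S.col j ⬝ᵥ S.col j ≤ maxColNorm S ^ 2 := by
  have hle : √(∑ i, S i j ^ 2) ≤ maxColNorm S :=
    le_ciSup (f := fun j => √(∑ i, S i j ^ 2)) (Set.finite_range _).bddAbove j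
  calc S.col j ⬝ᵥ S.col j = √(∑ i, S i j ^ 2) ^ 2 := by
        rw [Real.sq_sqrt (Finset.sum_nonneg fun i _ => sq_nonneg _)]
        simp [dotProduct, sq]
    _ ≤ maxColNorm S ^ 2 := by gcongr

lemma maxColNorm_nonneg (S : Matrix (Fin p) (Fin p) ℝ) : 0 ≤ maxColNorm S :=
  Real.iSup_nonneg fun _ => Real.sqrt_nonneg _

lemma one_le_maxColNorm (hdiag : ∀ i, S i i = 1) (j : Fin p) : 1 ≤ maxColNorm S := by
  refine (one_le_sq_iff₀ (maxColNorm_nonneg S)).mp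
    (le_trans ?_ (col_dotProduct_col_le_maxColNorm_sq S j))
  calc (1 : ℝ) = S j j * S j j := by rw [hdiag, one_mul]
    _ ≤ S.col j ⬝ᵥ S.col j := Finset.single_le_sum (f := fun i => S.col j i * S.col j i)
        (fun i _ => mul_self_nonneg _) (Finset.mem_univ j)

end CorrelationMatrices

section PairVectors

variable {κ : Type*} [DecidableEq κ]

/-- The vector `eᵢ + s eⱼ`: polarization over the two signs `s` recovers the `(i, j)` entry of a
symmetric matrix from its quadratic form. -/
def pairVec (i j : κ) (s : ℤˣ) : κ → ℝ :=
  Pi.single i 1 + ((s : ℤ) : ℝ) • Pi.single j 1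

lemma pairVec_apply_of_notMem {i j k : κ} (s : ℤˣ) (hk : k ∈ ({i, j}ᶜ : Set κ)) :
    pairVec i j s k = 0 := by
  have hki : k ≠ i := fun h => hk (.inl h)
  have hkj : k ≠ j := fun h => hk (.inr h)
  simp [pairVec, hki, hkj]

lemma indicator_compl_pair_eq_sub {i j : κ} (hij : i ≠ j) (x : κ → ℝ) :
    ({i, j}ᶜ : Set κ).indicator x = x - (Pi.single i (x i) + Pi.single j (x j)) := by
  ext k
  by_cases hi : k = i
  · subst hi; simp [hij]
  by_cases hj : k = j
  · subst hj; simp [hij]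
  simp [hi, hj]

end PairVectors

section QuadraticFormIdentities

variable {ι κ : Type*} [Fintype ι] [Fintype κ]

lemma dotProduct_transpose_mul_self_mulVec (M : Matrix ι κ ℝ) (x y : κ → ℝ) :
    x ⬝ᵥ (Mᵀ * M) *ᵥ y = (M *ᵥ x) ⬝ᵥ (M *ᵥ y) := by
  rw [← Matrix.mulVec_mulVec, Matrix.dotProduct_mulVec, Matrix.vecMul_transpose]

lemma transpose_mul_self_mulVec (M : Matrix ι κ ℝ) (x : κ → ℝ) :
    (Mᵀ * M) *ᵥ x = (M *ᵥ x) ᵥ* M := by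
  rw [← Matrix.mulVec_mulVec, Matrix.mulVec_transpose]

variable {S G T : Matrix κ κ ℝ}

/-- The variance of `⟨A c, Y⁽ˢ⁾⟩` conditionally on a sensing matrix `A` with Gram matrix `G`. -/
def projVar (S G : Matrix κ κ ℝ) (σ : ℝ) (c : κ → ℝ) : ℝ :=
  (G *ᵥ c) ⬝ᵥ S *ᵥ (G *ᵥ c) + σ ^ 2 * (c ⬝ᵥ G *ᵥ c)

lemma transpose_mul_mul_self (hS : S.IsHermitian) (hGt : Gᵀ = G) : (G * S * G)ᵀ = G * S * G := by
  rw [Matrix.transpose_mul, Matrix.transpose_mul, hGt, show Sᵀ = S from hS, Matrix.mul_assoc]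

lemma dotProduct_mul_mul_mulVec (hGt : Gᵀ = G) (c : κ → ℝ) :
    c ⬝ᵥ (G * S * G) *ᵥ c = (G *ᵥ c) ⬝ᵥ S *ᵥ (G *ᵥ c) := by
  rw [← Matrix.mulVec_mulVec, ← Matrix.mulVec_mulVec, Matrix.dotProduct_mulVec,
    ← Matrix.mulVec_transpose, hGt]

lemma quadForm_add_le_two_mul (hS : S.PosSemidef) (x y : κ → ℝ) :
    (x + y) ⬝ᵥ S *ᵥ (x + y) ≤ 2 * (x ⬝ᵥ S *ᵥ x) + 2 * (y ⬝ᵥ S *ᵥ y) := by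
  have hnonneg : 0 ≤ (x - y) ⬝ᵥ S *ᵥ (x - y) := hS.dotProduct_mulVec_nonneg (x - y)
  simp only [Matrix.mulVec_add, Matrix.mulVec_sub, dotProduct_add, dotProduct_sub, add_dotProduct,
    sub_dotProduct] at hnonneg ⊢
  linarith

variable [DecidableEq κ]

/-- The entries of `G c` outside `{i, j}`, where `c = eᵢ + s eⱼ`. When `G = Aᵀ A`, they are the
products of `A c` with the columns of `A` that are independent of it. -/
noncomputable def crossGram (G : Matrix κ κ ℝ) (i j : κ) (s : ℤˣ) : κ → ℝ :=
  ({i, j}ᶜ : Set κ).indicator (G *ᵥ pairVec i j s)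

lemma mulVec_pairVec_apply (M : Matrix κ κ ℝ) (i j k : κ) (s : ℤˣ) :
    (M *ᵥ pairVec i j s) k = M k i + ((s : ℤ) : ℝ) * M k j := by
  simp [pairVec, Matrix.mulVec_add, Matrix.mulVec_smul]

lemma quadForm_pairVec (M : Matrix κ κ ℝ) (i j : κ) (s : ℤˣ) :
    pairVec i j s ⬝ᵥ M *ᵥ pairVec i j s = M i i + M j j + ((s : ℤ) : ℝ) * (M i j + M j i) := by
  have hdot (x : κ → ℝ) : pairVec i j s ⬝ᵥ x = x i + ((s : ℤ) : ℝ) * x j := by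
    simp [pairVec, add_dotProduct, smul_dotProduct]
  have hsq : ((s : ℤ) : ℝ) * ((s : ℤ) : ℝ) = 1 := by
    rw [← Int.cast_mul, Int.units_coe_mul_self, Int.cast_one]
  rw [hdot, mulVec_pairVec_apply, mulVec_pairVec_apply]
  linear_combination M j j * hsq

omit [Fintype κ] [DecidableEq κ] in
lemma abs_apply_le_one [Finite κ] (hS : S.PosSemidef) (hdiag : ∀ i, S i i = 1) (i j : κ) :
    |S i j| ≤ 1 := by
  classical
  have := Fintype.ofFinite κ
  have hnonneg (s : ℤˣ) := (hS.dotProduct_mulVec_nonneg (pairVec i j s)).trans_eq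
    (quadForm_pairVec S i j s)
  have hsymm : S j i = S i j := hS.isHermitian.apply i j
  have hplus := hnonneg 1
  have hminus := hnonneg (-1)
  simp only [hdiag, hsymm, Units.val_one, Units.val_neg, Int.cast_one, Int.cast_neg] at hplus hminus
  exact abs_le.mpr ⟨by linarith, by linarith⟩

omit [DecidableEq κ] in
lemma quadForm_eq_quadForm_indicator_add (hS : S.IsHermitian) {i j : κ} (hij : i ≠ j)
    (x : κ → ℝ) :
    x ⬝ᵥ S *ᵥ x =
      ({i, j}ᶜ : Set κ).indicator x ⬝ᵥ S *ᵥ ({i, j}ᶜ : Set κ).indicator x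
        + 2 * (x i * (S *ᵥ x) i + x j * (S *ᵥ x) j)
        - (x i ^ 2 * S i i + x j ^ 2 * S j j + 2 * x i * x j * S i j) := by
  classical
  have hsymm : S j i = S i j := hS.apply i j
  have hcomm (k : κ) (a : ℝ) : x ⬝ᵥ S *ᵥ Pi.single k a = a * (S *ᵥ x) k := by
    rw [Matrix.dotProduct_mulVec, dotProduct_single, mul_comm, ← Matrix.mulVec_transpose,
      show Sᵀ = S from hS]
  rw [indicator_compl_pair_eq_sub hij]
  simp only [Matrix.mulVec_sub, Matrix.mulVec_add, dotProduct_sub, dotProduct_add, sub_dotProduct,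
    add_dotProduct, single_dotProduct, hcomm]
  simp only [Matrix.mulVec_single, Pi.smul_apply, MulOpposite.smul_eq_mul_unop,
    MulOpposite.unop_op, Matrix.col_apply, hsymm]
  ring

omit [DecidableEq κ] in
lemma quadForm_le_two_mul_quadForm_indicator_add (hS : S.PosSemidef) (hdiag : ∀ i, S i i = 1)
    {i j : κ} (hij : i ≠ j) (x : κ → ℝ) :
    x ⬝ᵥ S *ᵥ x ≤
      2 * (({i, j}ᶜ : Set κ).indicator x ⬝ᵥ S *ᵥ ({i, j}ᶜ : Set κ).indicator x)
        + 2 * (|x i| + |x j|) ^ 2 := by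
  classical
  have hsymm : S j i = S i j := hS.isHermitian.apply i j
  set z : κ → ℝ := Pi.single i (x i) + Pi.single j (x j) with hz
  have hpair : z ⬝ᵥ S *ᵥ z ≤ (|x i| + |x j|) ^ 2 := by
    have hcross : x i * x j * S i j ≤ |x i| * |x j| := by
      grw [le_abs_self (x i * x j * S i j), abs_mul, abs_mul, abs_apply_le_one hS hdiag, mul_one]
    calc z ⬝ᵥ S *ᵥ z = x i ^ 2 + x j ^ 2 + 2 * (x i * x j * S i j) := by
          simp only [hz, Matrix.mulVec_add, dotProduct_add, add_dotProduct, single_dotProduct,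
            Matrix.mulVec_single, Pi.smul_apply, MulOpposite.smul_eq_mul_unop,
            MulOpposite.unop_op, Matrix.col_apply, hsymm, hdiag]
          ring
      _ ≤ (|x i| + |x j|) ^ 2 := by rw [add_sq, sq_abs, sq_abs]; linarith
  have hsplit : ({i, j}ᶜ : Set κ).indicator x + z = x := by
    rw [indicator_compl_pair_eq_sub hij, sub_add_cancel]
  calc x ⬝ᵥ S *ᵥ x
      = (({i, j}ᶜ : Set κ).indicator x + z) ⬝ᵥ S *ᵥ
          (({i, j}ᶜ : Set κ).indicator x + z) := by rw [hsplit]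
    _ ≤ _ := quadForm_add_le_two_mul hS _ z
    _ ≤ _ := by grw [hpair]

lemma apply_eq_quadForm_pairVec_sub (hTt : Tᵀ = T) (i j : κ) :
    T i j =
      (pairVec i j 1 ⬝ᵥ T *ᵥ pairVec i j 1 - pairVec i j (-1) ⬝ᵥ T *ᵥ pairVec i j (-1)) / 4 := by
  have hsymm : T j i = T i j := congr_fun₂ hTt i j
  simp only [quadForm_pairVec, hsymm, Units.val_one, Units.val_neg, Int.cast_one, Int.cast_neg]
  ring

lemma mul_mul_apply_eq_crossGram_add (hS : S.IsHermitian) (hdiag : ∀ i, S i i = 1) (hGt : Gᵀ = G)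
    {i j : κ} (hij : i ≠ j) :
    (G * S * G) i j =
      (crossGram G i j 1 ⬝ᵥ S *ᵥ crossGram G i j 1
        - crossGram G i j (-1) ⬝ᵥ S *ᵥ crossGram G i j (-1)) / 4
      + (G i i * (G * S) j i + G j j * (G * S) i j
        + G i j * ((G * S) i i + (G * S) j j - G i i - G j j)
        - S i j * (G i i * G j j + G i j ^ 2)) := by
  have hSt : Sᵀ = S := hS
  have hSG (k l : κ) : (S * G) k l = (G * S) l k := by
    rw [← Matrix.transpose_apply (G * S), Matrix.transpose_mul, hGt, hSt]
  have hsymm : G j i = G i j := congr_fun₂ hGt i j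
  have hquad (s : ℤˣ) := (dotProduct_mul_mul_mulVec (S := S) hGt (pairVec i j s)).trans
    (quadForm_eq_quadForm_indicator_add hS hij _)
  rw [apply_eq_quadForm_pairVec_sub (transpose_mul_mul_self hS hGt), hquad, hquad]
  simp only [Matrix.mulVec_mulVec, mulVec_pairVec_apply, hSG, hdiag, hsymm, crossGram,
    Units.val_one, Units.val_neg, Int.cast_one, Int.cast_neg]
  ring

end QuadraticFormIdentities

section TypicalEvents

variable {n d p : ℕ}

/-- Deviation, at confidence level `u`, of the quadratic form of a correlation matrix `S` at a
standard Gaussian vector from its mean. -/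
noncomputable def quadFormDev (S : Matrix (Fin p) (Fin p) ℝ) (u : ℝ) : ℝ :=
  4 * √(u * ∑ i, ∑ j, S i j ^ 2) + 8 * u * (1 + offFrobNorm S)

/-- The conclusions, at confidence level `u`, of the concentration inequalities for the Gram matrix
`G` of a `d × p` sensing matrix. -/
structure IsTypicalGram (d : ℕ) (u : ℝ) (S G : Matrix (Fin p) (Fin p) ℝ) : Prop where
  abs_sub_one_le (i j : Fin p) : |G i j - (1 : Matrix (Fin p) (Fin p) ℝ) i j| ≤ relDev d u
  abs_mul_sub_le (i j : Fin p) : |(G * S) i j - S i j| ≤ relDev d u * maxColNorm S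
  abs_quadForm_crossGram_sub_le (i j : Fin p) (s : ℤˣ) :
    |crossGram G i j s ⬝ᵥ S *ᵥ crossGram G i j s
        - (pairVec i j s ⬝ᵥ G *ᵥ pairVec i j s) / d * ({i, j}ᶜ : Set (Fin p)).ncard|
      ≤ (pairVec i j s ⬝ᵥ G *ᵥ pairVec i j s) / d * quadFormDev S u

/-- The conclusion, at confidence level `u`, of the concentration inequality for the matrix
`T = Aᵀ ((1/n) ∑ₛ Y⁽ˢ⁾ Y⁽ˢ⁾ᵀ) A` around its conditional mean given `A`, where `G = Aᵀ A`. -/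
def IsTypicalMoment (n : ℕ) (u : ℝ) (S G T : Matrix (Fin p) (Fin p) ℝ) (σ : ℝ) : Prop :=
  ∀ i j s, |pairVec i j s ⬝ᵥ T *ᵥ pairVec i j s - projVar S G σ (pairVec i j s)|
    ≤ relDev n u * projVar S G σ (pairVec i j s)

lemma sum_indicator_diag_eq_ncard {κ : Type*} [Fintype κ] {S : Matrix κ κ ℝ}
    (hdiag : ∀ i, S i i = 1) (U : Set κ) : ∑ k, U.indicator (fun k => S k k) k = U.ncard := by
  classical
  simp only [Set.indicator_apply, hdiag, Finset.sum_boole, Set.ncard_eq_toFinset_card']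
  congr 2
  ext k
  simp

lemma measureReal_lt_abs_quadForm_moment_sub_le [NeZero n] {S : Matrix (Fin p) (Fin p) ℝ} {u : ℝ}
    (hS : S.PosSemidef) (σ : ℝ≥0) (hu : 0 ≤ u) (c : Fin p → ℝ) :
    (modelLaw n d p S σ).real
        {q | relDev n u * projVar S ((Matrix.of q.1)ᵀ * Matrix.of q.1) σ c <
          |c ⬝ᵥ ((Matrix.of q.1)ᵀ * empMoment (obs q.1 q.2.1 q.2.2) * Matrix.of q.1) *ᵥ c
            - projVar S ((Matrix.of q.1)ᵀ * Matrix.of q.1) σ c|}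
      ≤ 2 * Real.exp (-u) := by
  refine prod_measureReal_le_of_forall (IsOpen.measurableSet ?_) fun A => ?_
  · unfold projVar empMoment obs
    exact isOpen_lt (by fun_prop) (by fun_prop)
  have h := measureReal_lt_abs_quadForm_empMoment_sub_le (n := n) (d := d) (p := p) hS σ A
    (Matrix.of A *ᵥ c) (V := projVar S ((Matrix.of A)ᵀ * Matrix.of A) σ c) hu
    (by rw [projVar, transpose_mul_self_mulVec, ← transpose_mul_self_mulVec,
      dotProduct_transpose_mul_self_mulVec])
  have hquad (M : Matrix (Fin d) (Fin d) ℝ) :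
      c ⬝ᵥ ((Matrix.of A)ᵀ * M * Matrix.of A) *ᵥ c
        = (Matrix.of A *ᵥ c) ⬝ᵥ M *ᵥ (Matrix.of A *ᵥ c) := by
    rw [← Matrix.mulVec_mulVec, ← Matrix.mulVec_mulVec, Matrix.dotProduct_mulVec,
      Matrix.vecMul_transpose]
  simpa only [Set.preimage_ofPred_eq, hquad] using h

variable {S : Matrix (Fin p) (Fin p) ℝ} {u : ℝ}

lemma measureReal_lt_abs_gram_sub_one_le [NeZero d] (hu : 0 ≤ u) (i j : Fin p) :
    (iidGaussianMatrix (Fin d) (Fin p) (d : ℝ≥0)⁻¹).real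
        {A | relDev d u <
          |((Matrix.of A)ᵀ * Matrix.of A) i j - (1 : Matrix (Fin p) (Fin p) ℝ) i j|}
      ≤ 4 * Real.exp (-u) := by
  have h := measureReal_lt_abs_dotProduct_mulVec_sub_le (ι := Fin d) hu
    (x := (Pi.single i 1 : Fin p → ℝ)) (y := Pi.single j 1) one_pos one_pos (by simp) (by simp)
  simp only [← dotProduct_transpose_mul_self_mulVec] at h
  simpa [Matrix.one_apply, Pi.single_apply, eq_comm (a := j)] using h

lemma measureReal_lt_abs_gram_mul_sub_le [NeZero d] (hdiag : ∀ i, S i i = 1) (hu : 0 ≤ u)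
    (i j : Fin p) :
    (iidGaussianMatrix (Fin d) (Fin p) (d : ℝ≥0)⁻¹).real
        {A | relDev d u * maxColNorm S < |((Matrix.of A)ᵀ * Matrix.of A * S) i j - S i j|}
      ≤ 4 * Real.exp (-u) := by
  have h := measureReal_lt_abs_dotProduct_mulVec_sub_le (ι := Fin d) hu
    (x := (Pi.single i 1 : Fin p → ℝ)) one_pos (zero_lt_one.trans_le (one_le_maxColNorm hdiag j))
    (by simp) (col_dotProduct_col_le_maxColNorm_sq S j)
  simp only [← dotProduct_transpose_mul_self_mulVec, single_dotProduct, one_mul, Fintype.card_fin,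
    Matrix.col_apply] at h
  exact h

lemma measureReal_lt_abs_quadForm_crossGram_sub_le (hS : S.IsHermitian) (hdiag : ∀ i, S i i = 1)
    (hu : 0 ≤ u) (i j : Fin p) (s : ℤˣ) :
    (iidGaussianMatrix (Fin d) (Fin p) (d : ℝ≥0)⁻¹).real
        {A | (pairVec i j s ⬝ᵥ ((Matrix.of A)ᵀ * Matrix.of A) *ᵥ pairVec i j s) / d
              * quadFormDev S u <
          |crossGram ((Matrix.of A)ᵀ * Matrix.of A) i j s ⬝ᵥ
              S *ᵥ crossGram ((Matrix.of A)ᵀ * Matrix.of A) i j s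
            - (pairVec i j s ⬝ᵥ ((Matrix.of A)ᵀ * Matrix.of A) *ᵥ pairVec i j s) / d
              * ({i, j}ᶜ : Set (Fin p)).ncard|}
      ≤ 2 * Real.exp (-u) := by
  have h := measureReal_lt_abs_quadForm_indicator_gram_le (ι := Fin d) hS
    (add_nonneg zero_le_one (Real.sqrt_nonneg _))
    (abs_dotProduct_mulVec_le_one_add_offFrobNorm_mul hdiag) hu (d : ℝ≥0)⁻¹
    (fun k => pairVec_apply_of_notMem (i := i) (j := j) s)
  simp only [← dotProduct_transpose_mul_self_mulVec, ← transpose_mul_self_mulVec,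
    sum_indicator_diag_eq_ncard hdiag, NNReal.coe_inv, NNReal.coe_natCast,
    ← div_eq_mul_inv] at h
  exact h

lemma measureReal_not_isTypicalGram_le [NeZero d] (hS : S.IsHermitian) (hdiag : ∀ i, S i i = 1)
    (hu : 0 ≤ u) :
    (iidGaussianMatrix (Fin d) (Fin p) (d : ℝ≥0)⁻¹).real
        {A | ¬ IsTypicalGram d u S ((Matrix.of A)ᵀ * Matrix.of A)}
      ≤ 12 * (p : ℝ) ^ 2 * Real.exp (-u) := by
  set badEntry : Fin p × Fin p → Set (Fin d → Fin p → ℝ) := fun ij => {A | relDev d u <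
    |((Matrix.of A)ᵀ * Matrix.of A) ij.1 ij.2 - (1 : Matrix (Fin p) (Fin p) ℝ) ij.1 ij.2|}
  set badMul : Fin p × Fin p → Set (Fin d → Fin p → ℝ) := fun ij => {A |
    relDev d u * maxColNorm S < |((Matrix.of A)ᵀ * Matrix.of A * S) ij.1 ij.2 - S ij.1 ij.2|}
  set badQuadForm : Fin p × Fin p → ℤˣ → Set (Fin d → Fin p → ℝ) := fun ij s => {A |
    (pairVec ij.1 ij.2 s ⬝ᵥ ((Matrix.of A)ᵀ * Matrix.of A) *ᵥ pairVec ij.1 ij.2 s) / d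
        * quadFormDev S u <
      |crossGram ((Matrix.of A)ᵀ * Matrix.of A) ij.1 ij.2 s ⬝ᵥ
          S *ᵥ crossGram ((Matrix.of A)ᵀ * Matrix.of A) ij.1 ij.2 s
        - (pairVec ij.1 ij.2 s ⬝ᵥ ((Matrix.of A)ᵀ * Matrix.of A) *ᵥ pairVec ij.1 ij.2 s) / d
          * ({ij.1, ij.2}ᶜ : Set (Fin p)).ncard|}
  have hcover : {A | ¬ IsTypicalGram d u S ((Matrix.of A)ᵀ * Matrix.of A)}
      ⊆ ⋃ ij, (badEntry ij ∪ badMul ij) ∪ ⋃ s, badQuadForm ij s := by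
    intro A hA
    contrapose! hA
    simp only [Set.mem_iUnion, Set.mem_union, not_exists, not_or, Prod.forall] at hA
    exact not_not.mpr ⟨fun i j => not_lt.mp (hA i j).1.1, fun i j => not_lt.mp (hA i j).1.2,
      fun i j s => not_lt.mp ((hA i j).2 s)⟩
  have hentry (ij : Fin p × Fin p) :
      (iidGaussianMatrix (Fin d) (Fin p) (d : ℝ≥0)⁻¹).real
          ((badEntry ij ∪ badMul ij) ∪ ⋃ s, badQuadForm ij s)
        ≤ 12 * Real.exp (-u) := by
    have h₁ := measureReal_lt_abs_gram_sub_one_le (d := d) hu ij.1 ij.2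
    have h₂ := measureReal_lt_abs_gram_mul_sub_le (d := d) hdiag hu ij.1 ij.2
    have h₃ := (measureReal_iUnion_fintype_le _).trans (Finset.sum_le_card_nsmul _ _ _ fun s _ =>
      measureReal_lt_abs_quadForm_crossGram_sub_le (d := d) hS hdiag hu ij.1 ij.2 s)
    rw [Finset.card_univ, Fintype.card_units_int, two_nsmul] at h₃
    grw [measureReal_union_le, measureReal_union_le, h₁, h₂, h₃]
    exact le_of_eq (by ring)
  refine (measureReal_mono hcover).trans ((measureReal_iUnion_fintype_le _).trans
    ((Finset.sum_le_card_nsmul _ _ _ fun ij _ => hentry ij).trans ?_))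
  simp only [Finset.card_univ, Fintype.card_prod, Fintype.card_fin, nsmul_eq_mul, Nat.cast_mul]
  exact le_of_eq (by ring)

lemma measureReal_not_isTypicalMoment_le [NeZero n] (hS : S.PosSemidef) (σ : ℝ≥0) (hu : 0 ≤ u) :
    (modelLaw n d p S σ).real {q | ¬ IsTypicalMoment n u S ((Matrix.of q.1)ᵀ * Matrix.of q.1)
        ((Matrix.of q.1)ᵀ * empMoment (obs q.1 q.2.1 q.2.2) * Matrix.of q.1) σ}
      ≤ 4 * (p : ℝ) ^ 2 * Real.exp (-u) := by
  simp only [IsTypicalMoment, not_forall, not_le, Set.ofPred_exists]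
  have hentry (i j : Fin p) := (measureReal_iUnion_fintype_le _).trans
    (Finset.sum_le_card_nsmul _ _ _ fun s _ =>
      measureReal_lt_abs_quadForm_moment_sub_le (n := n) (d := d) hS σ hu (pairVec i j s))
  grw [measureReal_iUnion_fintype_le, Finset.sum_le_card_nsmul _ _ _ fun i _ =>
    (measureReal_iUnion_fintype_le _).trans (Finset.sum_le_card_nsmul _ _ _ fun j _ => hentry i j)]
  simp only [Finset.card_univ, Fintype.card_fin, Fintype.card_units_int, nsmul_eq_mul]
  exact le_of_eq (by push_cast; ring)

lemma measureReal_preimage_le_of_hasLaw {Ω α : Type*} [MeasurableSpace Ω] [MeasurableSpace α]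
    {P : Measure Ω} {μ : Measure α} [IsFiniteMeasure μ] {Z : Ω → α} (hZ : HasLaw Z μ P)
    (s : Set α) : P.real (Z ⁻¹' s) ≤ μ.real s := by
  refine ENNReal.toReal_mono (measure_ne_top _ _) ?_
  simpa only [hZ.map_eq] using Measure.le_map_apply hZ.aemeasurable s

lemma le_measureReal_isTypical [NeZero n] [NeZero d] (hS : S.PosSemidef)
    (hdiag : ∀ i, S i i = 1) (σ : ℝ≥0) (hu : 0 ≤ u)
    {Ω : Type*} [MeasurableSpace Ω] {P : Measure Ω} [IsProbabilityMeasure P]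
    {A : Ω → Fin d → Fin p → ℝ} {X : Ω → Fin n → EuclideanSpace ℝ (Fin p)}
    {W : Ω → Fin n → Fin d → ℝ}
    (hlaw : HasLaw (fun ω => (A ω, X ω, W ω)) (modelLaw n d p S σ) P) :
    1 - 16 * (p : ℝ) ^ 2 * Real.exp (-u) ≤ P.real {ω |
      IsTypicalGram d u S ((Matrix.of (A ω))ᵀ * Matrix.of (A ω)) ∧
      IsTypicalMoment n u S ((Matrix.of (A ω))ᵀ * Matrix.of (A ω))
        ((Matrix.of (A ω))ᵀ * empMoment (obs (A ω) (X ω) (W ω)) * Matrix.of (A ω)) σ} := by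
  have : IsProbabilityMeasure (modelLaw n d p S σ) := by unfold modelLaw; infer_instance
  have hlawA : HasLaw A (iidGaussianMatrix (Fin d) (Fin p) (d : ℝ≥0)⁻¹) P :=
    HasLaw.comp (Y := Prod.fst) ⟨by fun_prop, measurePreserving_fst.map_eq⟩ hlaw
  set typicalGram : Set Ω := {ω | IsTypicalGram d u S ((Matrix.of (A ω))ᵀ * Matrix.of (A ω))}
  set typicalMoment : Set Ω := {ω | IsTypicalMoment n u S ((Matrix.of (A ω))ᵀ * Matrix.of (A ω))
    ((Matrix.of (A ω))ᵀ * empMoment (obs (A ω) (X ω) (W ω)) * Matrix.of (A ω)) σ}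
  have hgram : P.real typicalGramᶜ ≤ _ := (measureReal_preimage_le_of_hasLaw hlawA _).trans
    (measureReal_not_isTypicalGram_le hS.isHermitian hdiag hu)
  have hmoment : P.real typicalMomentᶜ ≤ _ := (measureReal_preimage_le_of_hasLaw hlaw _).trans
    (measureReal_not_isTypicalMoment_le hS σ hu)
  have htotal : 1 ≤ P.real (typicalGram ∩ typicalMoment)
      + (P.real typicalGramᶜ + P.real typicalMomentᶜ) := by
    grw [← probReal_univ (μ := P), ← Set.union_compl_self (typicalGram ∩ typicalMoment),
      measureReal_union_le, Set.compl_inter, measureReal_union_le typicalGramᶜ]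
  change _ ≤ P.real (typicalGram ∩ typicalMoment)
  linarith

end TypicalEvents

section EntrywiseError

variable {n d p : ℕ} {S G T : Matrix (Fin p) (Fin p) ℝ} {σ : ℝ}

/-- The remainder in `mul_mul_apply_eq_crossGram_add`, with `g`, `h`, `t` the entries of `G` and
`a`, `b`, `e`, `f` those of `G S` in the rows and columns `i`, `j`, and `ρ = S i j`. -/
lemma abs_pair_error_le {g h t a b e f ρ ε m : ℝ} (hm : 1 ≤ m) (hρ : |ρ| ≤ 1)
    (hg : |g - 1| ≤ ε) (hh : |h - 1| ≤ ε) (ht : |t| ≤ ε) (ha : |a - 1| ≤ ε * m)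
    (hb : |b - 1| ≤ ε * m) (he : |e - ρ| ≤ ε * m) (hf : |f - ρ| ≤ ε * m) :
    |g * f + h * e + t * (a + b - g - h) - ρ * (g * h + t ^ 2) - ρ|
      ≤ 2 * ε * m + 8 * ε ^ 2 * m := by
  have hε : 0 ≤ ε := (abs_nonneg _).trans ht
  have hεm : ε ≤ ε * m := le_mul_of_one_le_right hε hm
  have hmul {x y y' : ℝ} (hx : |x| ≤ ε) (hy : |y| ≤ y') : |x * y| ≤ ε * y' := by
    rw [abs_mul]; gcongr
  have hρmul {x : ℝ} : |ρ * x| ≤ |x| := by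
    rw [abs_mul]; exact mul_le_of_le_one_left (abs_nonneg x) hρ
  have hinner : |(a - 1) + (b - 1) - (g - 1) - (h - 1)| ≤ 4 * (ε * m) := by
    grw [abs_sub, abs_sub, abs_add_le, ha, hb, hg, hh]
    linarith
  calc |g * f + h * e + t * (a + b - g - h) - ρ * (g * h + t ^ 2) - ρ|
      = |(f - ρ) + (e - ρ) + (g - 1) * (f - ρ) + (h - 1) * (e - ρ)
          + t * ((a - 1) + (b - 1) - (g - 1) - (h - 1))
          - ρ * ((g - 1) * (h - 1)) - ρ * (t * t)| := by congr 1; ring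
    _ ≤ ε * m + ε * m + ε * (ε * m) + ε * (ε * m) + ε * (4 * (ε * m)) + ε * (ε * m)
          + ε * (ε * m) := by
        grw [abs_sub, abs_sub, abs_add_le, abs_add_le, abs_add_le, abs_add_le, hρmul, hρmul,
          hf, he, hmul hg hf, hmul hh he, hmul ht hinner, hmul hg hh, hmul ht ht]
        gcongr
    _ = 2 * ε * m + 8 * ε ^ 2 * m := by ring

section TypicalGram

variable {u : ℝ}

lemma ncard_compl_pair_le (i j : Fin p) : (({i, j}ᶜ : Set (Fin p)).ncard : ℝ) ≤ p := by
  exact_mod_cast (Set.ncard_le_card _).trans_eq (by simp)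

lemma quadFormDev_nonneg (S : Matrix (Fin p) (Fin p) ℝ) (hu : 0 ≤ u) : 0 ≤ quadFormDev S u := by
  unfold quadFormDev offFrobNorm
  positivity

lemma IsTypicalGram.abs_quadForm_pairVec_sub_two_le (hG : IsTypicalGram d u S G) (hGt : Gᵀ = G)
    {i j : Fin p} (hij : i ≠ j) (s : ℤˣ) :
    |pairVec i j s ⬝ᵥ G *ᵥ pairVec i j s - 2| ≤ 4 * relDev d u := by
  have hii := hG.abs_sub_one_le i i
  have hjj := hG.abs_sub_one_le j j
  have hoff := hG.abs_sub_one_le i j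
  have hsymm : G j i = G i j := congr_fun₂ hGt i j
  rw [Matrix.one_apply_eq, abs_le] at hii hjj
  rw [Matrix.one_apply_ne hij, sub_zero, abs_le] at hoff
  rw [quadForm_pairVec, hsymm, abs_le]
  rcases Int.units_eq_one_or s with rfl | rfl
  · constructor <;> push_cast <;> linarith
  · constructor <;> push_cast <;> linarith

lemma IsTypicalGram.abs_mulVec_pairVec_apply_add_le (hG : IsTypicalGram d u S G) (hGt : Gᵀ = G)
    {i j : Fin p} (hij : i ≠ j) (s : ℤˣ) :
    |(G *ᵥ pairVec i j s) i| + |(G *ᵥ pairVec i j s) j| ≤ 2 + 4 * relDev d u := by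
  have hsymm : G j i = G i j := congr_fun₂ hGt i j
  have hdiagonal (k : Fin p) : |G k k| ≤ 1 + relDev d u := by
    have hkk := hG.abs_sub_one_le k k
    rw [Matrix.one_apply_eq, abs_le] at hkk
    exact abs_le.mpr ⟨by linarith, by linarith⟩
  have hoff : |G i j| ≤ relDev d u := by simpa [hij] using hG.abs_sub_one_le i j
  have hsign : |((s : ℤ) : ℝ)| = 1 := by
    rw [← Int.cast_abs, Int.isUnit_iff_abs_eq.mp s.isUnit, Int.cast_one]
  rw [mulVec_pairVec_apply, mulVec_pairVec_apply, hsymm]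
  grw [abs_add_le, abs_add_le, abs_mul, abs_mul, hsign, one_mul, one_mul, hdiagonal, hdiagonal,
    hoff]
  exact le_of_eq (by ring)

lemma abs_sub_le_of_abs_sub_mul_le {x y a b N h : ℝ} (hN : 0 ≤ N) (hx : |x - a * N| ≤ a * h)
    (hy : |y - b * N| ≤ b * h) : |x - y| ≤ |a - b| * N + (a + b) * h := by
  calc |x - y| = |(x - a * N) - (y - b * N) + (a - b) * N| := by congr 1; ring
    _ ≤ a * h + b * h + |a - b| * N := by
        grw [abs_add_le, abs_sub, hx, hy, abs_mul, abs_of_nonneg hN]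
    _ = |a - b| * N + (a + b) * h := by ring

/-- Each quadratic form is of order `p / d`; the difference is smaller because the means differ only
by the off-diagonal entry of `G`. -/
lemma IsTypicalGram.abs_crossGram_sub_crossGram_le (hG : IsTypicalGram d u S G) (hu : 0 ≤ u)
    (hGt : Gᵀ = G) {i j : Fin p} (hij : i ≠ j) :
    |(crossGram G i j 1 ⬝ᵥ S *ᵥ crossGram G i j 1
        - crossGram G i j (-1) ⬝ᵥ S *ᵥ crossGram G i j (-1)) / 4|
      ≤ p * relDev d u / d + (1 + relDev d u) * quadFormDev S u / d := by
  have hoff : |G i j| ≤ relDev d u := by simpa [hij] using hG.abs_sub_one_le i j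
  have hdiagonal (k : Fin p) : G k k ≤ 1 + relDev d u := by
    have hkk := (abs_le.mp (hG.abs_sub_one_le k k)).2
    rw [Matrix.one_apply_eq] at hkk
    linarith
  have hH : 0 ≤ quadFormDev S u := quadFormDev_nonneg S hu
  have hdiff := abs_sub_le_of_abs_sub_mul_le (Nat.cast_nonneg _)
    (hG.abs_quadForm_crossGram_sub_le i j 1) (hG.abs_quadForm_crossGram_sub_le i j (-1))
  have hmean_sub : (pairVec i j 1 ⬝ᵥ G *ᵥ pairVec i j 1) / d
      - (pairVec i j (-1) ⬝ᵥ G *ᵥ pairVec i j (-1)) / d = 4 * G i j / d := by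
    rw [apply_eq_quadForm_pairVec_sub hGt i j]
    ring
  have hmean_add : (pairVec i j 1 ⬝ᵥ G *ᵥ pairVec i j 1) / d
      + (pairVec i j (-1) ⬝ᵥ G *ᵥ pairVec i j (-1)) / d = 2 * (G i i + G j j) / d := by
    rw [quadForm_pairVec, quadForm_pairVec]
    push_cast
    ring
  rw [hmean_sub, hmean_add] at hdiff
  rw [abs_div, Nat.abs_ofNat]
  grw [hdiff, ncard_compl_pair_le, abs_div, abs_mul, Nat.abs_ofNat, Nat.abs_cast, hoff,
    hdiagonal, hdiagonal]
  exact le_of_eq (by ring)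

lemma IsTypicalGram.abs_mul_mul_sub_le (hG : IsTypicalGram d u S G) (hu : 0 ≤ u)
    (hS : S.PosSemidef) (hdiag : ∀ i, S i i = 1) (hGt : Gᵀ = G) {i j : Fin p} (hij : i ≠ j) :
    |(G * S * G) i j - S i j| ≤ 2 * relDev d u * maxColNorm S + 8 * relDev d u ^ 2 * maxColNorm S
      + (p * relDev d u / d + (1 + relDev d u) * quadFormDev S u / d) := by
  have hsymm : S j i = S i j := hS.isHermitian.apply i j
  have hpair := abs_pair_error_le (one_le_maxColNorm hdiag i) (abs_apply_le_one hS hdiag i j)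
    (by simpa using hG.abs_sub_one_le i i) (by simpa using hG.abs_sub_one_le j j)
    (by simpa [hij] using hG.abs_sub_one_le i j) (by simpa [hdiag] using hG.abs_mul_sub_le i i)
    (by simpa [hdiag] using hG.abs_mul_sub_le j j) (hG.abs_mul_sub_le i j)
    (by simpa [hsymm] using hG.abs_mul_sub_le j i)
  rw [mul_mul_apply_eq_crossGram_add hS.isHermitian hdiag hGt hij, add_sub_assoc, add_comm]
  exact (abs_add_le _ _).trans (add_le_add hpair (hG.abs_crossGram_sub_crossGram_le hu hGt hij))

lemma IsTypicalGram.projVar_pairVec_le (hG : IsTypicalGram d u S G) (hu : 0 ≤ u)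
    (hS : S.PosSemidef) (hdiag : ∀ i, S i i = 1) (hGt : Gᵀ = G) (σ : ℝ) {i j : Fin p}
    (hij : i ≠ j) (s : ℤˣ) :
    projVar S G σ (pairVec i j s) ≤
      2 * (2 + 4 * relDev d u) ^ 2 * (1 + (p + quadFormDev S u) / d + σ ^ 2) := by
  set κ := 2 + 4 * relDev d u
  have hκ₂ : 2 ≤ κ := by
    linarith [(abs_nonneg _).trans (hG.abs_sub_one_le i j)]
  set c := pairVec i j s
  have hβ : c ⬝ᵥ G *ᵥ c ≤ κ := by
    linarith [(abs_le.mp (hG.abs_quadForm_pairVec_sub_two_le hGt hij s)).2]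
  have hH : 0 ≤ quadFormDev S u := quadFormDev_nonneg S hu
  have hcoord : |(G *ᵥ c) i| + |(G *ᵥ c) j| ≤ κ :=
    hG.abs_mulVec_pairVec_apply_add_le hGt hij s
  have hcross : crossGram G i j s ⬝ᵥ S *ᵥ crossGram G i j s ≤ κ * (p + quadFormDev S u) / d := by
    calc crossGram G i j s ⬝ᵥ S *ᵥ crossGram G i j s
        ≤ (c ⬝ᵥ G *ᵥ c) / d * ({i, j}ᶜ : Set (Fin p)).ncard
          + (c ⬝ᵥ G *ᵥ c) / d * quadFormDev S u := by
          linarith [(abs_le.mp (hG.abs_quadForm_crossGram_sub_le i j s)).2]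
      _ ≤ κ / d * p + κ / d * quadFormDev S u := by grw [hβ, ncard_compl_pair_le]
      _ = κ * (p + quadFormDev S u) / d := by ring
  calc projVar S G σ c
      ≤ 2 * (κ * (p + quadFormDev S u) / d) + 2 * κ ^ 2 + σ ^ 2 * κ := by
        rw [projVar]
        grw [quadForm_le_two_mul_quadForm_indicator_add hS hdiag hij, hcoord, hβ]
        gcongr
        exact hcross
    _ = 2 * κ * ((p + quadFormDev S u) / d) + 2 * κ ^ 2 + κ * σ ^ 2 := by ring
    _ ≤ 2 * κ ^ 2 * ((p + quadFormDev S u) / d) + 2 * κ ^ 2 + 2 * κ ^ 2 * σ ^ 2 := by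
        gcongr <;> nlinarith
    _ = 2 * κ ^ 2 * (1 + (p + quadFormDev S u) / d + σ ^ 2) := by ring

lemma IsTypicalMoment.abs_sub_le (hT : IsTypicalMoment n u S G T σ)
    (hG : IsTypicalGram d u S G) (hu : 0 ≤ u) (hS : S.PosSemidef) (hdiag : ∀ i, S i i = 1)
    (hGt : Gᵀ = G) (hTt : Tᵀ = T) {i j : Fin p} (hij : i ≠ j) :
    |T i j - S i j| ≤ |(G * S * G) i j - S i j| + σ ^ 2 * relDev d u
      + relDev n u * ((2 + 4 * relDev d u) ^ 2 * (1 + (p + quadFormDev S u) / d + σ ^ 2)) := by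
  have hoff := hG.abs_sub_one_le i j
  rw [Matrix.one_apply_ne hij, sub_zero] at hoff
  set V : ℤˣ → ℝ := fun s => projVar S G σ (pairVec i j s)
  have hV (s : ℤˣ) := hG.projVar_pairVec_le hu hS hdiag hGt σ hij s
  have hmean : (V 1 - V (-1)) / 4 = (G * S * G) i j + σ ^ 2 * G i j := by
    rw [apply_eq_quadForm_pairVec_sub (transpose_mul_mul_self hS.isHermitian hGt),
      apply_eq_quadForm_pairVec_sub hGt, dotProduct_mul_mul_mulVec hGt,
      dotProduct_mul_mul_mulVec hGt]
    simp only [V, projVar]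
    ring
  set B := (2 + 4 * relDev d u) ^ 2 * (1 + (p + quadFormDev S u) / d + σ ^ 2) with hB
  have hdev (s : ℤˣ) : |pairVec i j s ⬝ᵥ T *ᵥ pairVec i j s - V s| ≤ relDev n u * (2 * B) := by
    grw [hT i j s, hV s, hB, mul_assoc]
    exact relDev_nonneg n.cast_nonneg hu
  have hnoise : |(pairVec i j 1 ⬝ᵥ T *ᵥ pairVec i j 1 - V 1) / 4
      - (pairVec i j (-1) ⬝ᵥ T *ᵥ pairVec i j (-1) - V (-1)) / 4| ≤ relDev n u * B := by
    have hplus := abs_le.mp (hdev 1)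
    have hminus := abs_le.mp (hdev (-1))
    exact abs_le.mpr ⟨by linarith, by linarith⟩
  calc |T i j - S i j|
      = |((G * S * G) i j - S i j) + σ ^ 2 * G i j
          + ((pairVec i j 1 ⬝ᵥ T *ᵥ pairVec i j 1 - V 1) / 4
            - (pairVec i j (-1) ⬝ᵥ T *ᵥ pairVec i j (-1) - V (-1)) / 4)| := by
        rw [apply_eq_quadForm_pairVec_sub hTt]
        congr 1
        linear_combination hmean
    _ ≤ |(G * S * G) i j - S i j| + σ ^ 2 * relDev d u + relDev n u * B := by
        refine (abs_add_le _ _).trans (add_le_add ((abs_add_le _ _).trans ?_) hnoise)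
        grw [abs_mul, hoff, abs_of_nonneg (sq_nonneg σ)]

end TypicalGram

end EntrywiseError

section ErrorRate

variable {n d p : ℕ} {S : Matrix (Fin p) (Fin p) ℝ}

/-- The rate at which the entrywise error is controlled, up to a constant. It is a lower bound for
the rate in `tauInf`, and the noise enters it only through `σ² (√(log p / n) + √(log p / d))`. -/
noncomputable def errorRate (n d p : ℕ) (S : Matrix (Fin p) (Fin p) ℝ) (σ : ℝ) : ℝ :=
  √(Real.log p / n) * (1 + p * Real.log p / d + σ ^ 2)
    + √(Real.log p / d) * (maxColNorm S + p / d + σ ^ 2)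
    + (√(p * Real.log p) + Real.log p * offFrobNorm S) / d

lemma errorRate_nonneg (n d p : ℕ) (S : Matrix (Fin p) (Fin p) ℝ) (σ : ℝ) :
    0 ≤ errorRate n d p S σ := by
  have hm : 0 ≤ maxColNorm S := maxColNorm_nonneg S
  have hF : 0 ≤ offFrobNorm S := Real.sqrt_nonneg _
  unfold errorRate
  positivity

lemma rpow_three_halves {x : ℝ} (hx : 0 ≤ x) : x ^ (3 / 2 : ℝ) = x * √x := by
  rw [show (3 / 2 : ℝ) = 1 + 1 / 2 by norm_num, Real.rpow_add' hx (by norm_num), Real.rpow_one,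
    Real.sqrt_eq_rpow]

lemma mul_errorRate_le_tauInf [NeZero d] {C : ℝ} (hC : 0 ≤ C)
    (S : Matrix (Fin p) (Fin p) ℝ) (σ : ℝ≥0) : C * errorRate n d p S σ ≤ tauInf C n d p S σ := by
  have hd : (0 : ℝ) < d := Nat.cast_pos.mpr (NeZero.pos d)
  have hL : 0 ≤ Real.log p := Real.log_natCast_nonneg p
  have hF : 0 ≤ offFrobNorm S := Real.sqrt_nonneg _
  have hpd : (1 : ℝ) ≤ 1 + p / d := le_add_of_nonneg_right (by positivity)
  simp only [tauInf, errorRate]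
  set L := Real.log p
  have hoffFrob : L * offFrobNorm S / d ≤ L / d * (1 + p / d) * offFrobNorm S := by
    rw [mul_div_right_comm]
    gcongr
    exact le_mul_of_one_le_right (by positivity) hpd
  have hdim : √(L / n) * (p * L / d) ≤ p * L ^ (3 / 2 : ℝ) / (√n * d) * (1 + p / d) := by
    refine (le_of_eq ?_).trans (le_mul_of_one_le_right (by positivity) hpd)
    rw [rpow_three_halves hL, Real.sqrt_div hL]
    field_simp
  have hratio : √(L / d) * (p / d) = p * √L / (d : ℝ) ^ (3 / 2 : ℝ) := by
    rw [rpow_three_halves hd.le, Real.sqrt_div hL]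
    field_simp
  have hnoise : √(L / n) * (σ : ℝ) ^ 2 + √(L / d) * (σ : ℝ) ^ 2
      ≤ (σ : ℝ) ^ 2 * (1 + √(L / d)) * √(L / d) * (1 + max √((d : ℝ) / n) ((d : ℝ) / n)) := by
    have hsplit : √(L / n) = √(L / d) * √((d : ℝ) / n) := by
      rw [← Real.sqrt_mul (by positivity), div_mul_div_cancel₀ hd.ne']
    calc √(L / n) * (σ : ℝ) ^ 2 + √(L / d) * (σ : ℝ) ^ 2
        = (σ : ℝ) ^ 2 * 1 * √(L / d) * (1 + √((d : ℝ) / n)) := by rw [hsplit]; ring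
      _ ≤ _ := by
        gcongr
        · exact le_add_of_nonneg_right (Real.sqrt_nonneg _)
        · exact le_max_left _ _
  have hmixed : 0 ≤ L * √p / √(n * d) := by positivity
  refine mul_le_mul_of_nonneg_left ?_ hC
  linarith [add_div √(p * L) (L * offFrobNorm S) d]

lemma relDev_three_mul_le {N L B : ℝ} (hL : 0 ≤ L) (hN : 0 ≤ N) (hB : √(L / N) ≤ B) :
    relDev N (3 * L) ≤ (7 + 24 * B) * √(L / N) := by
  have hthree : √3 ≤ 7 / 4 := Real.sqrt_le_iff.mpr ⟨by norm_num, by norm_num⟩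
  calc relDev N (3 * L) = (4 * √3 + 24 * √(L / N)) * √(L / N) := by
        have hsq : √(L / N) * √(L / N) = L / N := Real.mul_self_sqrt (by positivity)
        rw [relDev, mul_div_assoc, Real.sqrt_mul (by norm_num)]
        linear_combination -24 * hsq
    _ ≤ (7 + 24 * B) * √(L / N) := by
        gcongr
        linarith

lemma offFrobNorm_le (hS : ∀ i j, |S i j| ≤ 1) : offFrobNorm S ≤ p := by
  refine Real.sqrt_le_iff.mpr ⟨p.cast_nonneg, ?_⟩
  calc ∑ i, ∑ j, (if i = j then 0 else S i j ^ 2) ≤ ∑ _i : Fin p, ∑ _j : Fin p, (1 : ℝ) := by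
        gcongr with i _ j _
        split_ifs
        · exact zero_le_one
        · exact (sq_le_one_iff_abs_le_one _).mpr (hS i j)
    _ = (p : ℝ) ^ 2 := by simp [sq]

lemma quadFormDev_three_mul_le (hdiag : ∀ i, S i i = 1) {L : ℝ} (hL : 1 ≤ L) (hLp : L ≤ p) :
    quadFormDev S (3 * L) ≤ 31 * (√(p * L) + L * offFrobNorm S) := by
  have hF : 0 ≤ offFrobNorm S := Real.sqrt_nonneg _
  have hthree : √3 ≤ 7 / 4 := Real.sqrt_le_iff.mpr ⟨by norm_num, by norm_num⟩
  have hLsqrt : L ≤ √(p * L) := Real.le_sqrt_of_sq_le (by rw [sq]; gcongr)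
  have hfrob : √(L * (p + offFrobNorm S ^ 2)) ≤ √(p * L) + L * offFrobNorm S := by
    refine Real.sqrt_le_iff.mpr ⟨by positivity, ?_⟩
    rw [add_sq, Real.sq_sqrt (by positivity)]
    have hcross : 0 ≤ 2 * √(p * L) * (L * offFrobNorm S) := by positivity
    have hLsq : L * offFrobNorm S ^ 2 ≤ (L * offFrobNorm S) ^ 2 := by
      rw [mul_pow]
      gcongr
      exact le_self_pow₀ hL two_ne_zero
    linarith
  calc quadFormDev S (3 * L)
      = 4 * (√3 * √(L * (p + offFrobNorm S ^ 2))) + 24 * (L + L * offFrobNorm S) := by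
        rw [quadFormDev, sum_sq_eq_add_offFrobNorm_sq hdiag, mul_assoc,
          Real.sqrt_mul (by norm_num)]
        ring
    _ ≤ 4 * (7 / 4 * (√(p * L) + L * offFrobNorm S)) + 24 * (√(p * L) + L * offFrobNorm S) := by
        gcongr
    _ = 31 * (√(p * L) + L * offFrobNorm S) := by ring

lemma sqrt_log_div_le_one [NeZero d] (hd : Real.log p ≤ d) : √(Real.log p / d) ≤ 1 :=
  Real.sqrt_le_one.mpr ((div_le_one (Nat.cast_pos.mpr (NeZero.pos d))).mpr hd)

lemma relDev_three_mul_log_le [NeZero d] (hd : Real.log p ≤ d) :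
    relDev d (3 * Real.log p) ≤ 31 * √(Real.log p / d) :=
  (relDev_three_mul_le (Real.log_natCast_nonneg p) d.cast_nonneg (sqrt_log_div_le_one hd)).trans_eq
    (by norm_num)

lemma IsTypicalGram.abs_mul_mul_sub_le_of_log_le [NeZero d] {G : Matrix (Fin p) (Fin p) ℝ}
    (hG : IsTypicalGram d (3 * Real.log p) S G) (hS : S.PosSemidef) (hdiag : ∀ i, S i i = 1)
    (hGt : Gᵀ = G) (hp : 1 ≤ Real.log p) (hd : Real.log p ≤ d) {i j : Fin p} (hij : i ≠ j) :
    |(G * S * G) i j - S i j| ≤ 7750 * (√(Real.log p / d) * (maxColNorm S + p / d)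
      + (√(p * Real.log p) + Real.log p * offFrobNorm S) / d) := by
  refine (hG.abs_mul_mul_sub_le (by positivity) hS hdiag hGt hij).trans ?_
  have hm : 0 ≤ maxColNorm S := maxColNorm_nonneg S
  have hF : 0 ≤ offFrobNorm S := Real.sqrt_nonneg _
  have hH := quadFormDev_three_mul_le hdiag hp (Real.log_le_self p.cast_nonneg)
  have hε := relDev_three_mul_log_le hd
  have hr := sqrt_log_div_le_one hd
  have hε₀ : 0 ≤ relDev d (3 * Real.log p) := relDev_nonneg d.cast_nonneg (by positivity)
  set ε := relDev d (3 * Real.log p)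
  set r := √(Real.log p / d)
  set h := √(p * Real.log p) + Real.log p * offFrobNorm S
  have hH₀ : 0 ≤ quadFormDev S (3 * Real.log p) := quadFormDev_nonneg S (by positivity)
  have hε₁ : ε ≤ 31 := by linarith
  calc 2 * ε * maxColNorm S + 8 * ε ^ 2 * maxColNorm S
        + (p * ε / d + (1 + ε) * quadFormDev S (3 * Real.log p) / d)
      = (2 + 8 * ε) * (ε * maxColNorm S) + p * ε / d
          + (1 + ε) * quadFormDev S (3 * Real.log p) / d := by ring
    _ ≤ (2 + 8 * 31) * (31 * r * maxColNorm S) + p * (31 * r) / d + (1 + 31) * (31 * h) / d := by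
        gcongr
    _ = 7750 * (r * maxColNorm S) + 31 * (r * (p / d)) + 992 * (h / d) := by ring
    _ ≤ 7750 * (r * maxColNorm S) + 7750 * (r * (p / d)) + 7750 * (h / d) := by
        gcongr <;> norm_num
    _ = 7750 * (r * (maxColNorm S + p / d) + h / d) := by ring

lemma abs_div_add_one_mul_sub_le {D x y : ℝ} (hD : 0 < D) :
    |D / (D + 1) * x - y| ≤ |x - y| + |y| / D := by
  calc |D / (D + 1) * x - y| = |D / (D + 1) * (x - y) - y / (D + 1)| := by
        congr 1
        field_simp
        ring
    _ ≤ 1 * |x - y| + |y| / D := by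
        refine (abs_sub _ _).trans (add_le_add ?_ ?_)
        · rw [abs_mul, abs_of_nonneg (by positivity)]
          gcongr
          exact (div_le_one (by positivity)).mpr (by linarith)
        · rw [abs_div, abs_of_pos (by positivity : 0 < D + 1)]
          gcongr
          linarith
    _ = |x - y| + |y| / D := by rw [one_mul]

lemma one_div_le_sqrt_log_div [NeZero d] (hp : 1 ≤ Real.log p) :
    1 / (d : ℝ) ≤ √(Real.log p / d) := by
  have hd : (1 : ℝ) ≤ d := Nat.one_le_cast.mpr (NeZero.pos d)
  refine Real.le_sqrt_of_sq_le ?_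
  calc (1 / (d : ℝ)) ^ 2 ≤ 1 / d :=
        pow_le_of_le_one (by positivity) ((div_le_one (by linarith)).mpr hd) two_ne_zero
    _ ≤ Real.log p / d := by gcongr

end ErrorRate

section Estimator

variable {n d p : ℕ} {S G T : Matrix (Fin p) (Fin p) ℝ}

lemma add_quadFormDev_three_mul_log_le (hS : ∀ i j, |S i j| ≤ 1) (hdiag : ∀ i, S i i = 1)
    (hp : 1 ≤ Real.log p) :
    p + quadFormDev S (3 * Real.log p) ≤ 63 * (p * Real.log p) := by
  have hLp : Real.log p ≤ p := Real.log_le_self p.cast_nonneg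
  have hpL : (p : ℝ) ≤ p * Real.log p := le_mul_of_one_le_right p.cast_nonneg hp
  have hsqrt : √(p * Real.log p) ≤ p * Real.log p :=
    Real.sqrt_le_iff.mpr ⟨by positivity, le_self_pow₀ (by linarith) two_ne_zero⟩
  have hoff : Real.log p * offFrobNorm S ≤ Real.log p * p := by grw [offFrobNorm_le hS]
  linarith [quadFormDev_three_mul_le hdiag hp hLp]

lemma relDev_mul_sq_mul_le [NeZero n] [NeZero d]
    (hS : ∀ i j, |S i j| ≤ 1) (hdiag : ∀ i, S i i = 1) {K : ℝ} (hK : 0 ≤ K)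
    (hp : 1 ≤ Real.log p) (hd : Real.log p ≤ d) (hn : Real.log p ≤ K * n) (σ : ℝ) :
    relDev n (3 * Real.log p) * ((2 + 4 * relDev d (3 * Real.log p)) ^ 2
        * (1 + (p + quadFormDev S (3 * Real.log p)) / d + σ ^ 2))
      ≤ 32000000 * (1 + K) * (√(Real.log p / n) * (1 + p * Real.log p / d + σ ^ 2)) := by
  have hn₀ : (0 : ℝ) < n := Nat.cast_pos.mpr (NeZero.pos n)
  have hε₀ : 0 ≤ relDev d (3 * Real.log p) := relDev_nonneg d.cast_nonneg (by positivity)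
  have hε₁ : relDev d (3 * Real.log p) ≤ 31 := by
    linarith [relDev_three_mul_log_le hd, sqrt_log_div_le_one hd]
  have hsqrtK : √(Real.log p / n) ≤ 1 + K := by
    refine Real.sqrt_le_iff.mpr ⟨by positivity, ((div_le_iff₀ hn₀).mpr hn).trans ?_⟩
    nlinarith
  have hδ := relDev_three_mul_le (Real.log_natCast_nonneg p) hn₀.le hsqrtK
  have hquad := add_quadFormDev_three_mul_log_le hS hdiag hp
  have hH : 0 ≤ quadFormDev S (3 * Real.log p) := quadFormDev_nonneg S (by positivity)
  set a := √(Real.log p / n)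
  calc relDev n (3 * Real.log p) * ((2 + 4 * relDev d (3 * Real.log p)) ^ 2
        * (1 + (p + quadFormDev S (3 * Real.log p)) / d + σ ^ 2))
      ≤ (7 * (1 + K) + 24 * (1 + K)) * a * ((2 + 4 * 31) ^ 2
          * (63 * 1 + 63 * (p * Real.log p) / d + 63 * σ ^ 2)) := by
        grw [hδ]
        gcongr
        · linarith
        · norm_num
        · linarith [sq_nonneg σ]
    _ = 31005828 * ((1 + K) * (a * (1 + p * Real.log p / d + σ ^ 2))) := by ring
    _ ≤ 32000000 * ((1 + K) * (a * (1 + p * Real.log p / d + σ ^ 2))) := by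
        gcongr
        norm_num
    _ = 32000000 * (1 + K) * (a * (1 + p * Real.log p / d + σ ^ 2)) := by ring

lemma IsTypicalMoment.abs_shrinkage_sub_le [NeZero n] [NeZero d] {σ K : ℝ}
    (hT : IsTypicalMoment n (3 * Real.log p) S G T σ)
    (hG : IsTypicalGram d (3 * Real.log p) S G) (hS : S.PosSemidef) (hdiag : ∀ i, S i i = 1)
    (hGt : Gᵀ = G) (hTt : Tᵀ = T) (hK : 0 ≤ K) (hp : 1 ≤ Real.log p) (hd : Real.log p ≤ d)
    (hn : Real.log p ≤ K * n) {i j : Fin p} (hij : i ≠ j) :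
    |(d : ℝ) / (d + 1) * T i j - S i j| ≤ 32000000 * (1 + K) * errorRate n d p S σ := by
  have hSone := abs_apply_le_one hS hdiag
  have hmoment := hT.abs_sub_le hG (by positivity) hS hdiag hGt hTt hij
  have hbias := hG.abs_mul_mul_sub_le_of_log_le hS hdiag hGt hp hd hij
  have hfluct := relDev_mul_sq_mul_le (n := n) hSone hdiag hK hp hd hn σ
  have hnoise : σ ^ 2 * relDev d (3 * Real.log p) ≤ σ ^ 2 * (31 * √(Real.log p / d)) := by
    grw [relDev_three_mul_log_le hd]
  have hshrink : |S i j| / d ≤ √(Real.log p / d) * maxColNorm S := by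
    grw [hSone, one_div_le_sqrt_log_div hp]
    exact le_mul_of_one_le_right (Real.sqrt_nonneg _) (one_le_maxColNorm hdiag i)
  have hm : 0 ≤ maxColNorm S := maxColNorm_nonneg S
  have hF : 0 ≤ offFrobNorm S := Real.sqrt_nonneg _
  grw [abs_div_add_one_mul_sub_le (Nat.cast_pos.mpr (NeZero.pos d)), hmoment, hbias, hfluct,
    hnoise, hshrink]
  unfold errorRate
  set r := √(Real.log p / d)
  set h := (√(p * Real.log p) + Real.log p * offFrobNorm S) / d
  set f := √(Real.log p / n) * (1 + p * Real.log p / d + σ ^ 2)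
  have hr_ratio : 0 ≤ r * (p / d) := by positivity
  have hr_noise : 0 ≤ r * σ ^ 2 := by positivity
  have hh : 0 ≤ h := by positivity
  calc 7750 * (r * (maxColNorm S + p / d) + h) + σ ^ 2 * (31 * r) + 32000000 * (1 + K) * f
        + r * maxColNorm S
      ≤ 7751 * (r * (maxColNorm S + p / d + σ ^ 2) + h) + 32000000 * (1 + K) * f := by
        linarith
    _ ≤ 32000000 * (1 + K) * (r * (maxColNorm S + p / d + σ ^ 2) + h)
          + 32000000 * (1 + K) * f := by
        gcongr
        linarith
    _ = 32000000 * (1 + K) * (f + r * (maxColNorm S + p / d + σ ^ 2) + h) := by ring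

lemma covEstimator_apply_self (A : Fin d → Fin p → ℝ) (Y : Fin n → Fin d → ℝ) (i : Fin p) :
    covEstimator A Y i i = 1 := by
  simp [covEstimator, offDiag]

lemma covEstimator_apply_of_ne (A : Fin d → Fin p → ℝ) (Y : Fin n → Fin d → ℝ) {i j : Fin p}
    (hij : i ≠ j) : covEstimator A Y i j =
      (d : ℝ) / (d + 1) * ((Matrix.of A)ᵀ * empMoment Y * Matrix.of A) i j := by
  simp [covEstimator, offDiag, hij]

lemma transpose_empMoment (Y : Fin n → Fin d → ℝ) : (empMoment Y)ᵀ = empMoment Y := by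
  simp [empMoment, Matrix.transpose_sum, Matrix.transpose_vecMulVec]

lemma maxNorm_covEstimator_sub_le [NeZero n] [NeZero d] {K : ℝ} {σ : ℝ≥0}
    {A : Fin d → Fin p → ℝ} {Y : Fin n → Fin d → ℝ}
    (hG : IsTypicalGram d (3 * Real.log p) S ((Matrix.of A)ᵀ * Matrix.of A))
    (hT : IsTypicalMoment n (3 * Real.log p) S ((Matrix.of A)ᵀ * Matrix.of A)
      ((Matrix.of A)ᵀ * empMoment Y * Matrix.of A) σ)
    (hS : S.PosSemidef) (hdiag : ∀ i, S i i = 1) (hK : 0 ≤ K) (hp : 1 ≤ Real.log p)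
    (hd : Real.log p ≤ d) (hn : Real.log p ≤ K * n) :
    maxNorm (covEstimator A Y - S) ≤ tauInf (32000000 * (1 + K)) n d p S σ := by
  have hGt : ((Matrix.of A)ᵀ * Matrix.of A)ᵀ = (Matrix.of A)ᵀ * Matrix.of A := by
    rw [Matrix.transpose_mul, Matrix.transpose_transpose]
  have hTt : ((Matrix.of A)ᵀ * empMoment Y * Matrix.of A)ᵀ
      = (Matrix.of A)ᵀ * empMoment Y * Matrix.of A := by
    rw [Matrix.transpose_mul, Matrix.transpose_mul, Matrix.transpose_transpose,
      transpose_empMoment, Matrix.mul_assoc]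
  refine le_trans ?_ (mul_errorRate_le_tauInf (by positivity) S σ)
  have hrate : 0 ≤ 32000000 * (1 + K) * errorRate n d p S σ :=
    mul_nonneg (by positivity) (errorRate_nonneg n d p S σ)
  refine Real.iSup_le (fun i => Real.iSup_le (fun j => ?_) hrate) hrate
  rw [Matrix.sub_apply]
  rcases eq_or_ne i j with rfl | hij
  · simpa [covEstimator_apply_self, hdiag] using hrate
  · rw [covEstimator_apply_of_ne A Y hij]
    exact hT.abs_shrinkage_sub_le hG hS hdiag hGt hTt hK hp hd hn hij

lemma sq_mul_exp_neg_three_mul_log (hp : 0 < p) :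
    (p : ℝ) ^ 2 * Real.exp (-(3 * Real.log p)) = (p : ℝ)⁻¹ := by
  have hp₀ : (0 : ℝ) < p := Nat.cast_pos.mpr hp
  have hcube : Real.exp (3 * Real.log p) = (p : ℝ) ^ 3 := by
    rw [← Real.exp_log hp₀, ← Real.exp_nat_mul, Real.exp_log hp₀]
    norm_num
  rw [Real.exp_neg, hcube]
  field_simp

theorem le_measureReal_maxNorm_covEstimator_sub_le [NeZero n] [NeZero d] {K : ℝ} {σ : ℝ≥0}
    (hS : S.PosSemidef) (hdiag : ∀ i, S i i = 1) (hK : 0 ≤ K) (hp : 1 ≤ Real.log p)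
    (hd : Real.log p ≤ d) (hn : Real.log p ≤ K * n)
    {Ω : Type*} [MeasurableSpace Ω] {P : Measure Ω} [IsProbabilityMeasure P]
    {A : Ω → Fin d → Fin p → ℝ} {X : Ω → Fin n → EuclideanSpace ℝ (Fin p)}
    {W : Ω → Fin n → Fin d → ℝ}
    (hlaw : HasLaw (fun ω => (A ω, X ω, W ω)) (modelLaw n d p S σ) P) :
    1 - 16 * (p : ℝ)⁻¹ ≤ P.real {ω | maxNorm (covEstimator (A ω) (obs (A ω) (X ω) (W ω)) - S)
      ≤ tauInf (32000000 * (1 + K)) n d p S σ} := by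
  have hp₀ : 0 < p := Nat.pos_of_ne_zero (by rintro rfl; norm_num at hp)
  rw [← sq_mul_exp_neg_three_mul_log hp₀, ← mul_assoc]
  refine (le_measureReal_isTypical hS hdiag σ (by positivity) hlaw).trans (measureReal_mono ?_)
  exact fun ω hω => maxNorm_covEstimator_sub_le hω.1 hω.2 hS hdiag hK hp hd hn

lemma one_le_log_natCast (hp : 3 ≤ p) : 1 ≤ Real.log p := by
  have hp₀ : (3 : ℝ) ≤ p := Nat.ofNat_le_cast.mpr hp
  rw [Real.le_log_iff_exp_le (by linarith)]
  linarith [Real.exp_one_lt_d9]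

lemma one_le_sq_mul_exp_neg (hp : 0 < p) {x : ℝ} (hx : x ≤ Real.log p) :
    1 ≤ (p : ℝ) ^ 2 * Real.exp (-x) := by
  have hp₀ : (1 : ℝ) ≤ p := Nat.one_le_cast.mpr hp
  calc (1 : ℝ) ≤ p := hp₀
    _ = (p : ℝ) ^ 2 * Real.exp (-Real.log p) := by
        rw [Real.exp_neg, Real.exp_log (by linarith)]
        field_simp
    _ ≤ (p : ℝ) ^ 2 * Real.exp (-x) := by gcongr

end Estimator

end IndirectCov

theorem mainTheorem2 (K : ℝ) (hK : 0 < K) :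
    ∃ c₀ c₁ c₂ c₃ c₄ C : ℝ, 0 < c₀ ∧ 0 < c₁ ∧ 0 < c₂ ∧ 0 < c₃ ∧ 0 < c₄ ∧ 0 < C ∧
      ∀ (n d p : ℕ), 0 < n → 0 < d → 0 < p → Real.log p ≤ K * n →
      ∀ (S : Matrix (Fin p) (Fin p) ℝ), S.PosSemidef → (∀ i, S i i = 1) →
      ∀ (σ : ℝ≥0) (Ω : Type*) [MeasurableSpace Ω] (P : Measure Ω) [IsProbabilityMeasure P]
        (A : Ω → Fin d → Fin p → ℝ) (X : Ω → Fin n → EuclideanSpace ℝ (Fin p))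
        (W : Ω → Fin n → Fin d → ℝ),
      HasLaw (fun ω => (A ω, X ω, W ω)) (IndirectCov.modelLaw n d p S σ) P →
      1 - c₀ * (p : ℝ)⁻¹ - c₁ * (p : ℝ) ^ 2 * Real.exp (-(c₂ * d))
          - c₃ * (p : ℝ) ^ 2 * Real.exp (-(c₄ * p)) ≤
        P.real {ω | IndirectCov.maxNorm
          (IndirectCov.covEstimator (A ω) (IndirectCov.obs (A ω) (X ω) (W ω)) - S)
            ≤ IndirectCov.tauInf C n d p S σ} := by
  refine ⟨16, 1, 1, 1, 1, 32000000 * (1 + K), by norm_num, one_pos, one_pos, one_pos, one_pos,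
    by positivity, fun n d p hn hd hp hlog S hS hdiag σ Ω _ P _ A X W hlaw => ?_⟩
  have : NeZero n := ⟨hn.ne'⟩
  have : NeZero d := ⟨hd.ne'⟩
  have hprob_nonneg := measureReal_nonneg (μ := P) (s := {ω | IndirectCov.maxNorm
    (IndirectCov.covEstimator (A ω) (IndirectCov.obs (A ω) (X ω) (W ω)) - S)
      ≤ IndirectCov.tauInf (32000000 * (1 + K)) n d p S σ})
  have hexp_nonneg (x : ℝ) : 0 ≤ (p : ℝ) ^ 2 * Real.exp (-x) := by positivity
  simp only [one_mul]
  rcases lt_or_ge p 3 with hp₃ | hp₃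
  · have hsmall : 1 ≤ 16 * (p : ℝ)⁻¹ := by
      rw [← div_eq_mul_inv, one_le_div (Nat.cast_pos.mpr hp)]
      exact_mod_cast (hp₃.trans (by norm_num)).le
    linarith [hexp_nonneg d, hexp_nonneg p]
  rcases lt_or_ge (d : ℝ) (Real.log p) with hd_log | hd_log
  · have hinv : 0 ≤ 16 * (p : ℝ)⁻¹ := by positivity
    linarith [IndirectCov.one_le_sq_mul_exp_neg hp hd_log.le, hexp_nonneg p]
  · linarith [IndirectCov.le_measureReal_maxNorm_covEstimator_sub_le hS hdiag hK.le
      (IndirectCov.one_le_log_natCast hp₃) hd_log hlog hlaw, hexp_nonneg d, hexp_nonneg p]
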